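/- There is a universal constant $c>1$ with the following property. Let $\{(X_i,a_i)\}_{i\ge 0}$ be a controlled Markov chain on a probability space with filtration $\{\mathcal F_i\}$, with finite state space $\chi$, $|\chi|=d$, finite control space $\mathbb I$, $|\mathbb I|=k$, and transition matrices $M^{(l)}$, $l\in\mathbb I$: $X_i$ and $a_i$ are $\mathcal F_i$-measurable and $\mathbb P(X_{i+1}=t\mid\mathcal F_i)=M^{(a_i)}_{X_i,t}$ a.s.; the law of $(X_0,a_0)$ is arbitrary. Suppose that the controls are stationary: for $i\ge1$, the conditional law of $a_i$ given $X_i=s$ and any history $(X_0,a_0,\dots,X_{i-1},a_{i-1})$ of positive probability depends only on $s$. Suppose moreover that: (1) there are $\zeta_2>0$ and $\zeta_1<1$ and, for every $i\ge1$, a set $\mathcal S_i\subset\chi\times\mathbb I$ with $\zeta_2\le\mathbb P((X_i,a_i)\in\mathcal S_i)\le\zeta_1$; (2) $T$ is a positive integer such that almost surely $\sup_{s,l,i\ge1}\mathbb E\big[\tau^{(i)}_{s,l}\mid\mathcal F_{\sigma^{(i-1)}_{s,l}}\big]<T$, where $\sigma^{(0)}_{s,l}=0$, $\sigma^{(i)}_{s,l}=\min\{n>\sigma^{(i-1)}_{s,l}:X_n=s,\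 a_n=l\}$ (with $\min\emptyset=\infty$) and $\tau^{(i)}_{s,l}=\sigma^{(i)}_{s,l}-\sigma^{(i-1)}_{s,l}$ is the $i$-th return time of $(s,l)$; (3) $\mathbb C_\theta\ge0$ satisfies $\sup_{i\ge1}\sum_{j>i}\bar\theta_{i,j}\le\mathbb C_\theta$, where $\bar\theta_{i,j}$ is the largest total variation distance between the laws of $X_j$ conditional on $(X_i,a_i)=(s_1,l_1)$ and on $(X_i,a_i)=(s_2,l_2)$, over distinct pairs $(s_1,l_1),(s_2,l_2)$ of positive probability ($0$ if there are no two such pairs). Let $\hat M^{(l)}_{s,t}=N^{(l)}_{s,t}/N^{(l)}_s$ (and $0$ if $N_s^{(l)}=0$), where $N^{(l)}_s=\sum_{i=1}^m\mathbf 1[X_i=s,a_i=l]$ and $N^{(l)}_{s,t}=\sum_{i=1}^m\mathbf 1[X_i=s,X_{i+1}=t,a_i=l]$. Let $0<\alpha<1$ and $g\in\mathbb R^{\chi}$, let $\pi(\cdot\mid s)$, $s\in\chi$, be probability vectors on $\mathbb I$ (a stationary policy), and put $M_{s,t}=\sum_l\pi(l\mid s)M^{(l)}_{s,t}$ and $\hat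 M_{s,t}=\sum_l\pi(l\mid s)\hat M^{(l)}_{s,t}$; if $k=1$ these are just the transition matrix of the chain and its empirical estimate. Let $$V=(I-\alpha M)^{-1}g,\qquad \hat V=(I-\alpha\hat M)^{-1}g,\qquad T_\alpha=\frac{\|g\|_1^2\,d\,\alpha^2\,T}{(1-\alpha)^4}.$$ Let $\varepsilon>0$ and $\delta\in(0,1)$. If the integer $m$ satisfies $$m>c\,\max\left\{\frac{T_\alpha}{\varepsilon^2}\log\left(\frac{dkT_\alpha}{\varepsilon^2\delta}\right),\ \mathbb C_\theta^2\max\left\{T^2,\frac1{(1-\max\{\zeta_1,1-\zeta_2\})^2}\right\}\log\left(\frac{dk}{\delta}\right)\right\}$$ (the first expression being read as $0$ if $T_\alpha=0$), then $$\mathbb P\big(\|\hat V-V\|>\varepsilon\big)<\delta,$$ where $\|\cdot\|$ is the Euclidean norm (hence the same holds for the sup norm). -/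

import Mathlib

open MeasureTheory ProbabilityTheory
open scoped ENNReal Matrix

namespace CMC

noncomputable section

variable {Ω χ I : Type*}

/-! ### Controlled Markov chains with stationary controls -/

/-- `(X i, a i)` is a controlled Markov chain for the filtration `ℱ`, with states in `χ`, controls
in `I` and transition matrices `M l`, `l : I`: both processes are adapted and
`P(X (i+1) = t | ℱ i) = M (a i) (X i) t` almost surely. The law of `(X 0, a 0)` is arbitrary. -/
structure IsControlledMarkovChain {mΩ : MeasurableSpace Ω} [Fintype χ] [DecidableEq χ]
    [MeasurableSpace χ] [MeasurableSpace I] (μ : Measure Ω) (ℱ : Filtration ℕ mΩ)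
    (X : ℕ → Ω → χ) (a : ℕ → Ω → I) (M : I → Matrix χ χ ℝ) : Prop where
  adapted_state : Adapted ℱ X
  adapted_control : Adapted ℱ a
  stochastic : ∀ l, M l ∈ Matrix.rowStochastic ℝ χ
  transition : ∀ (i : ℕ) (t : χ),
    μ[{ω | X (i + 1) ω = t}.indicator (fun _ => (1 : ℝ)) | ℱ i]
      =ᵐ[μ] fun ω => M (a i ω) (X i ω) t

/-- The event that the states and controls before time `i` are the prescribed ones. -/
def historyEvent (X : ℕ → Ω → χ) (a : ℕ → Ω → I) (i : ℕ) (h : ℕ → χ × I) : Set Ω :=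
  {ω | ∀ j < i, (X j ω, a j ω) = h j}

/-- Stationary randomised controls: for every time `i ≥ 1`, given `X i = s` and any history before
time `i` (of positive probability), the control `a i` has a law `P s` that depends only on `s`. -/
def HasStationaryControls [MeasurableSpace Ω] [Fintype I] (μ : Measure Ω)
    (X : ℕ → Ω → χ) (a : ℕ → Ω → I) : Prop :=
  ∃ P : χ → I → ℝ, (∀ s, P s ∈ stdSimplex ℝ I) ∧
    ∀ (i : ℕ), 1 ≤ i → ∀ (s : χ) (h : ℕ → χ × I),
      μ ({ω | X i ω = s} ∩ historyEvent X a i h) ≠ 0 →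
      ∀ l : I, (μ[|{ω | X i ω = s} ∩ historyEvent X a i h]).real {ω | a i ω = l} = P s l

/-! ### Return times -/

/-- `visitTime X a s l i` is the time of the `i`-th visit to `(s, l)` at a positive time
(`⊤` if there is none), with value `0` for `i = 0`. -/
def visitTime (X : ℕ → Ω → χ) (a : ℕ → Ω → I) (s : χ) (l : I) : ℕ → Ω → ℕ∞
  | 0, _ => 0
  | i + 1, ω =>
      ⨅ (n : ℕ) (_ : visitTime X a s l i ω < (n : ℕ∞) ∧ X n ω = s ∧ a n ω = l), (n : ℕ∞)

/-- The `i`-th time to return (`i ≥ 1`): the time from the `(i-1)`-st to the `i`-th visit. -/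
def returnTime (X : ℕ → Ω → χ) (a : ℕ → Ω → I) (s : χ) (l : I) (i : ℕ) (ω : Ω) : ℕ∞ :=
  visitTime X a s l i ω - visitTime X a s l (i - 1) ω

theorem visitTime_succ_le_iff (X : ℕ → Ω → χ) (a : ℕ → Ω → I) (s : χ) (l : I) (i n : ℕ) (ω : Ω) :
    visitTime X a s l (i + 1) ω ≤ (n : ℕ∞) ↔
      ∃ k ≤ n, visitTime X a s l i ω < (k : ℕ∞) ∧ X k ω = s ∧ a k ω = l := by
  constructor
  · intro h
    have h1 : visitTime X a s l (i + 1) ω < ((n + 1 : ℕ) : ℕ∞) :=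
      lt_of_le_of_lt h (by exact_mod_cast Nat.lt_succ_self n)
    simp only [visitTime, iInf_lt_iff] at h1
    obtain ⟨k, hk, hkn⟩ := h1
    exact ⟨k, Nat.lt_succ_iff.mp (by exact_mod_cast hkn), hk⟩
  · rintro ⟨k, hkn, hk⟩
    have h2 : visitTime X a s l (i + 1) ω ≤ (k : ℕ∞) := by
      simp only [visitTime]
      exact iInf₂_le k hk
    exact h2.trans (by exact_mod_cast hkn)

/-- Visit times are stopping times, so that the `σ`-algebra of the past of a visit makes sense. -/
theorem isStoppingTime_visitTime {mΩ : MeasurableSpace Ω} [MeasurableSpace χ]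
    [MeasurableSingletonClass χ] [MeasurableSpace I] [MeasurableSingletonClass I]
    {ℱ : Filtration ℕ mΩ} {X : ℕ → Ω → χ} {a : ℕ → Ω → I} (hX : Adapted ℱ X) (ha : Adapted ℱ a)
    (s : χ) (l : I) (i : ℕ) : IsStoppingTime ℱ (visitTime X a s l i) := by
  induction i with
  | zero => exact isStoppingTime_const ℱ 0
  | succ i ih =>
    intro n
    have hset : {ω | visitTime X a s l (i + 1) ω ≤ (n : ℕ∞)} =
        ⋃ k ∈ Set.Iic n, ({ω | visitTime X a s l i ω < (k : ℕ∞)} ∩ (X k ⁻¹' {s} ∩ a k ⁻¹' {l})) := by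
      ext ω
      simp only [Set.mem_ofPred_eq, visitTime_succ_le_iff, Set.mem_iUnion, Set.mem_Iic,
        Set.mem_inter_iff, Set.mem_preimage, Set.mem_singleton_iff, exists_prop]
    have key : MeasurableSet[ℱ n] {ω | visitTime X a s l (i + 1) ω ≤ (n : ℕ∞)} := by
      rw [hset]
      refine MeasurableSet.biUnion (Set.to_countable _) fun k hk => ?_
      refine ℱ.mono hk _ ?_
      exact (ih.measurableSet_lt_of_pred k).inter
        ((hX k (measurableSet_singleton s)).inter (ha k (measurableSet_singleton l)))
    exact key

/-- The return-time condition with constant `T`: almost surely,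
`sup_{s, l, i ≥ 1} E[i-th return time of (s, l) | past of the (i-1)-st visit] < T`.
The conditional expectations are those of `[0, ∞]`-valued functions. -/
def ReturnTimeBound {mΩ : MeasurableSpace Ω} [MeasurableSpace χ] [MeasurableSingletonClass χ]
    [MeasurableSpace I] [MeasurableSingletonClass I] (μ : Measure Ω) {ℱ : Filtration ℕ mΩ}
    {X : ℕ → Ω → χ} {a : ℕ → Ω → I} (hX : Adapted ℱ X) (ha : Adapted ℱ a) (T : ℕ) : Prop :=
  ∀ᵐ ω ∂μ, (⨆ (s : χ) (l : I) (i : ℕ),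
    condLExp (isStoppingTime_visitTime hX ha s l i).measurableSpace μ
      (fun ω' => ((returnTime X a s l (i + 1) ω' : ℕ∞) : ℝ≥0∞)) ω) < (T : ℝ≥0∞)

/-! ### Non-degeneracy and mixing -/

/-- At every time `i ≥ 1` there is a set of state-control pairs whose probability lies in
`[ζ₂, ζ₁]`, where `0 < ζ₂` and `ζ₁ < 1`. -/
def Nondegenerate [MeasurableSpace Ω] (μ : Measure Ω) (X : ℕ → Ω → χ) (a : ℕ → Ω → I)
    (ζ₁ ζ₂ : ℝ) : Prop :=
  0 < ζ₂ ∧ ζ₁ < 1 ∧ ∀ i : ℕ, 1 ≤ i → ∃ S : Set (χ × I),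
    ζ₂ ≤ μ.real {ω | (X i ω, a i ω) ∈ S} ∧ μ.real {ω | (X i ω, a i ω) ∈ S} ≤ ζ₁

/-- Total variation distance (supremum over events). -/
def tvDist [MeasurableSpace χ] (ν₁ ν₂ : Measure χ) : ℝ :=
  ⨆ A : Set χ, |ν₁.real A - ν₂.real A|

/-- The mixing coefficient of the states: the largest total variation distance between the
conditional laws of `X j` given two distinct values of `(X i, a i)` of positive probability. -/
def thetaBar [MeasurableSpace Ω] [MeasurableSpace χ] (μ : Measure Ω) (X : ℕ → Ω → χ)
    (a : ℕ → Ω → I) (i j : ℕ) : ℝ :=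
  sSup {r : ℝ | ∃ (s₁ : χ) (l₁ : I) (s₂ : χ) (l₂ : I), (s₁, l₁) ≠ (s₂, l₂) ∧
    μ {ω | X i ω = s₁ ∧ a i ω = l₁} ≠ 0 ∧ μ {ω | X i ω = s₂ ∧ a i ω = l₂} ≠ 0 ∧
    r = tvDist ((μ[|{ω | X i ω = s₁ ∧ a i ω = l₁}]).map (X j))
      ((μ[|{ω | X i ω = s₂ ∧ a i ω = l₂}]).map (X j))}

/-- Mixing of the states with constant `C ≥ 0`: `sup_{i ≥ 1} ∑_{j > i} θ̄_{i,j} ≤ C`. -/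
def StateMixing [MeasurableSpace Ω] [MeasurableSpace χ] (μ : Measure Ω) (X : ℕ → Ω → χ)
    (a : ℕ → Ω → I) (C : ℝ) : Prop :=
  0 ≤ C ∧ ∀ i : ℕ, 1 ≤ i →
    Summable (fun n : ℕ => thetaBar μ X a i (i + 1 + n)) ∧
      ∑' n : ℕ, thetaBar μ X a i (i + 1 + n) ≤ C

/-! ### Estimators and value functions -/

/-- Number of visits to the state-control pair `(s, l)` at the times `1, …, m`. -/
def visitCount [DecidableEq χ] [DecidableEq I] (X : ℕ → Ω → χ) (a : ℕ → Ω → I) (m : ℕ)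
    (s : χ) (l : I) (ω : Ω) : ℕ :=
  ((Finset.Icc 1 m).filter fun i => X i ω = s ∧ a i ω = l).card

/-- Number of transitions from `s` to `t` under the control `l` at the times `1, …, m`. -/
def transitionCount [DecidableEq χ] [DecidableEq I] (X : ℕ → Ω → χ) (a : ℕ → Ω → I) (m : ℕ)
    (s t : χ) (l : I) (ω : Ω) : ℕ :=
  ((Finset.Icc 1 m).filter fun i => X i ω = s ∧ X (i + 1) ω = t ∧ a i ω = l).card

/-- The empirical transition matrices; the row of a pair that was not visited is `0`. -/
def empiricalMatrix [DecidableEq χ] [DecidableEq I] (X : ℕ → Ω → χ) (a : ℕ → Ω → I) (m : ℕ)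
    (ω : Ω) (l : I) : Matrix χ χ ℝ :=
  Matrix.of fun s t => (transitionCount X a m s t l ω : ℝ) / (visitCount X a m s l ω : ℝ)

/-- The state transition matrix under the stationary policy `π`. If there is only one control `l`,
this is `M l`. -/
def policyMatrix [Fintype I] (π : χ → I → ℝ) (M : I → Matrix χ χ ℝ) : Matrix χ χ ℝ :=
  Matrix.of fun s t => ∑ l, π s l * M l s t

/-- The discounted value `(I - α Q)⁻¹ g`. The matrix is invertible if `0 < α < 1` and the entries
of `Q` are nonnegative with row sums at most `1`. -/
def discountedValue [Fintype χ] [DecidableEq χ] (α : ℝ) (Q : Matrix χ χ ℝ) (g : χ → ℝ) : χ → ℝ :=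
  (1 - α • Q)⁻¹ *ᵥ g

/-- The effective constant `T_α = ‖g‖₁² d α² T / (1 - α)⁴`. -/
def effectiveT [Fintype χ] (α : ℝ) (g : χ → ℝ) (T : ℕ) : ℝ :=
  (∑ s, |g s|) ^ 2 * (Fintype.card χ : ℝ) * α ^ 2 * (T : ℝ) / (1 - α) ^ 4

end

end CMC

/-!
The error of the estimated value function is controlled through the Bellman equation
`V = α M V + g`: if `(M̂ - M) V` is at most `η` in sup norm, then `V̂ - V` is at most
`α η √d / (1 - α)` in Euclidean norm (`CMC.norm_discountedValue_sub_le`). As `V` is bounded by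
`‖g‖₁ / (1 - α)` and oscillates by no more than that, the error never exceeds `√(T_α / T)`. So only
the case `T_α / ε² > T` is of interest, and there the first part of the sample size condition also
gives `m ≥ c T log (2 d k / δ)`, since `T ≥ 2`.

By stationarity of the controls, the pairs `Z i = (X i, a i)` form a homogeneous Markov chain with a
transition matrix `K` on `χ × I`. Two probability estimates are needed for each pair `w = (s, l)`.

*Number of visits.* Let `G n z` be the expected number of visits to `w` in `n` steps from `z`. The
bound on return times gives the renewal inequality `n + 1 ≤ T (1 + G n w)` and shows that visits to
`w` are possible at times with gaps of at most `T`. Mixing says that `G n z` and `G n z'` differ by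
at most `Cθ` if `z` and `z'` are possible at the same time. Hence `G L z ≥ 1 + Cθ` for a block
length `L` of order `T (1 + Cθ)` and every possible `z`. The second moment of the number `N` of
visits in a block is bounded by mixing once more, through the mean itself, so that
`E (1 - c) ^ N ≤ 7 / 8` for some `c` of order `1 / (1 + Cθ)` (`CMC.FrequentVisits.discountedVisits_block_le`). Independently of
the past this holds for each of about `m / L` blocks, and Markov's inequality gives at least
`m / (128 T)` visits up to probability `exp (- m / (32 T (4 + 2 Cθ)))`
(`CMC.measureReal_card_visits_le`). The sample size needed here is of order
`T (1 + Cθ) log (2 d k / δ)`: for `Cθ ≤ 1` the condition `m ≥ c T log (2 d k / δ)` covers it, and for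
`Cθ > 1` the second part of the sample size condition does, because `T (1 + Cθ) ≤ 2 Cθ² T²`.

*Deviation of a row.* The sum of the centred values `V (X (i + 1)) - (M l V) s` over the visits to
`(s, l)` has an exponential supermartingale with the number of visits as its clock, by Hoeffding's
lemma for a single transition. With a fixed parameter it bounds the probability that the average
exceeds `η` while the number of visits is at least `n₀`, with no union over the possible numbers of
visits (`CMC.measureReal_centredSum_ge_le`).
-/

namespace CMC

/-! ### Discounted values of substochastic matrices -/

section DiscountedValue

variable {χ : Type*} [Fintype χ] {α : ℝ} {Q R : Matrix χ χ ℝ}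

theorem abs_sum_mul_le {q v : χ → ℝ} {B : ℝ} (hq : ∀ t, 0 ≤ q t) (hq1 : ∑ t, q t ≤ 1)
    (hB : 0 ≤ B) (hv : ∀ t, |v t| ≤ B) : |∑ t, q t * v t| ≤ B := by
  calc |∑ t, q t * v t| ≤ ∑ t, |q t * v t| := Finset.abs_sum_le_sum_abs _ _
    _ ≤ ∑ t, q t * B := Finset.sum_le_sum fun t _ => by
        rw [abs_mul, abs_of_nonneg (hq t)]
        exact mul_le_mul_of_nonneg_left (hv t) (hq t)
    _ = (∑ t, q t) * B := (Finset.sum_mul ..).symm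
    _ ≤ 1 * B := mul_le_mul_of_nonneg_right hq1 hB
    _ = B := one_mul B

/-- A vector `D` with `D = α Q D + E`, `Q` substochastic, is bounded by `sup |E| / (1 - α)`. -/
theorem abs_le_of_eq_smul_mulVec_add (hα : α ∈ Set.Ioo (0 : ℝ) 1) (hQ : ∀ s t, 0 ≤ Q s t)
    (hQ1 : ∀ s, ∑ t, Q s t ≤ 1) {D E : χ → ℝ} {B : ℝ}
    (hD : ∀ s, D s = α * (Q *ᵥ D) s + E s) (hE : ∀ s, |E s| ≤ B) (s : χ) :
    |D s| ≤ B / (1 - α) := by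
  obtain ⟨u, -, hu⟩ := Finset.exists_max_image Finset.univ (fun t => |D t|) ⟨s, Finset.mem_univ s⟩
  have h1 : |(Q *ᵥ D) u| ≤ |D u| :=
    abs_sum_mul_le (hQ u) (hQ1 u) (abs_nonneg _) fun t => hu t (Finset.mem_univ t)
  have h2 : |D u| ≤ α * |D u| + B := by
    calc |D u| = |α * (Q *ᵥ D) u + E u| := by rw [← hD u]
      _ ≤ |α * (Q *ᵥ D) u| + |E u| := abs_add_le _ _
      _ ≤ α * |D u| + B := by
        rw [abs_mul, abs_of_pos hα.1]
        exact add_le_add (mul_le_mul_of_nonneg_left h1 hα.1.le) (hE u)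
  refine (hu s (Finset.mem_univ s)).trans ?_
  rw [le_div_iff₀ (sub_pos.2 hα.2)]
  linarith

variable [DecidableEq χ]

theorem isUnit_one_sub_smul (hα : α ∈ Set.Ioo (0 : ℝ) 1) (hQ : ∀ s t, 0 ≤ Q s t)
    (hQ1 : ∀ s, ∑ t, Q s t ≤ 1) : IsUnit (1 - α • Q) := by
  rw [← Matrix.mulVec_injective_iff_isUnit, ← Matrix.coe_mulVecLin, ← LinearMap.ker_eq_bot,
    LinearMap.ker_eq_bot']
  intro D hD
  funext s
  have h : ∀ s, D s = α * (Q *ᵥ D) s + 0 := fun s => by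
    have := congrFun hD s
    simp only [Matrix.coe_mulVecLin, Matrix.sub_mulVec, Matrix.one_mulVec, Matrix.smul_mulVec,
      Pi.sub_apply, Pi.smul_apply, smul_eq_mul, Pi.zero_apply] at this
    linarith
  have := abs_le_of_eq_smul_mulVec_add hα hQ hQ1 (E := fun _ => 0) (B := 0) h (by simp) s
  simpa using this

/-- The discounted value solves the Bellman equation `V = α Q V + g`. -/
theorem discountedValue_eq (hα : α ∈ Set.Ioo (0 : ℝ) 1) (hQ : ∀ s t, 0 ≤ Q s t)
    (hQ1 : ∀ s, ∑ t, Q s t ≤ 1) (g : χ → ℝ) (s : χ) :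
    discountedValue α Q g s = α * (Q *ᵥ discountedValue α Q g) s + g s := by
  have h : (1 - α • Q) *ᵥ discountedValue α Q g = g := by
    rw [discountedValue, Matrix.mulVec_mulVec, Matrix.mul_nonsing_inv _
      ((Matrix.isUnit_iff_isUnit_det _).1 (isUnit_one_sub_smul hα hQ hQ1)), Matrix.one_mulVec]
  have := congrFun h s
  simp only [Matrix.sub_mulVec, Matrix.one_mulVec, Matrix.smul_mulVec, Pi.sub_apply,
    Pi.smul_apply, smul_eq_mul] at this
  linarith

theorem abs_discountedValue_le (hα : α ∈ Set.Ioo (0 : ℝ) 1) (hQ : ∀ s t, 0 ≤ Q s t)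
    (hQ1 : ∀ s, ∑ t, Q s t ≤ 1) (g : χ → ℝ) (s : χ) :
    |discountedValue α Q g s| ≤ (∑ t, |g t|) / (1 - α) :=
  abs_le_of_eq_smul_mulVec_add hα hQ hQ1 (discountedValue_eq hα hQ hQ1 g)
    (fun s => Finset.single_le_sum (f := fun t => |g t|) (fun _ _ => abs_nonneg _)
      (Finset.mem_univ s)) s

/-- For a stochastic matrix, the discounted value oscillates by at most `‖g‖₁ / (1 - α)`. -/
theorem discountedValue_sub_le (hα : α ∈ Set.Ioo (0 : ℝ) 1)
    (hQ : Q ∈ Matrix.rowStochastic ℝ χ) (g : χ → ℝ) (s t : χ) :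
    discountedValue α Q g s - discountedValue α Q g t ≤ (∑ t, |g t|) / (1 - α) := by
  have hQ0 : ∀ s t, 0 ≤ Q s t := fun s t => Matrix.nonneg_of_mem_rowStochastic hQ
  have hQ1 := Matrix.sum_row_of_mem_rowStochastic hQ
  set V := discountedValue α Q g with hV
  have hVeq : ∀ s, V s = α * (Q *ᵥ V) s + g s :=
    discountedValue_eq hα hQ0 (fun s => (hQ1 s).le) g
  obtain ⟨u, -, hu⟩ := Finset.exists_max_image Finset.univ V ⟨s, Finset.mem_univ s⟩
  obtain ⟨w, -, hw⟩ := Finset.exists_min_image Finset.univ V ⟨s, Finset.mem_univ s⟩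
  have h1 : (Q *ᵥ V) u ≤ V u := by
    calc (Q *ᵥ V) u ≤ ∑ t, Q u t * V u := Finset.sum_le_sum fun t ht =>
          mul_le_mul_of_nonneg_left (hu t ht) (hQ0 u t)
      _ = V u := by rw [← Finset.sum_mul, hQ1, one_mul]
  have h2 : V w ≤ (Q *ᵥ V) w := by
    calc V w = ∑ t, Q w t * V w := by rw [← Finset.sum_mul, hQ1, one_mul]
      _ ≤ (Q *ᵥ V) w := Finset.sum_le_sum fun t ht =>
          mul_le_mul_of_nonneg_left (hw t ht) (hQ0 w t)
  have h3 : g u - g w ≤ ∑ t, |g t| := by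
    by_cases huw : u = w
    · rw [huw, sub_self]
      exact Finset.sum_nonneg fun _ _ => abs_nonneg _
    · calc g u - g w ≤ |g u| + |g w| := by
            linarith [le_abs_self (g u), neg_abs_le (g w)]
        _ = ∑ t ∈ {u, w}, |g t| := by rw [Finset.sum_pair huw]
        _ ≤ ∑ t, |g t| := Finset.sum_le_sum_of_subset_of_nonneg (Finset.subset_univ _)
            fun _ _ _ => abs_nonneg _
  have h4 : V s - V t ≤ V u - V w :=
    sub_le_sub (hu s (Finset.mem_univ s)) (hw t (Finset.mem_univ t))
  refine h4.trans ?_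
  rw [le_div_iff₀ (sub_pos.2 hα.2)]
  have := mul_le_mul_of_nonneg_left h1 hα.1.le
  have := mul_le_mul_of_nonneg_left h2 hα.1.le
  linarith [hVeq u, hVeq w]

/-- Perturbation bound: if `R` is substochastic and `(R - Q) V` is at most `η` in sup norm, where
`V` is the discounted value of `Q`, then the discounted values of `R` and `Q` differ by at most
`α η √d / (1 - α)` in Euclidean norm. -/
theorem norm_discountedValue_sub_le (hα : α ∈ Set.Ioo (0 : ℝ) 1) (hQ : ∀ s t, 0 ≤ Q s t)
    (hQ1 : ∀ s, ∑ t, Q s t ≤ 1) (hR : ∀ s t, 0 ≤ R s t) (hR1 : ∀ s, ∑ t, R s t ≤ 1) (g : χ → ℝ)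
    {η : ℝ} (hη0 : 0 ≤ η) (hη : ∀ s, |((R - Q) *ᵥ discountedValue α Q g) s| ≤ η) :
    ‖WithLp.toLp 2 (discountedValue α R g - discountedValue α Q g)‖
      ≤ √(Fintype.card χ) * (α * η / (1 - α)) := by
  set V := discountedValue α Q g
  set W := discountedValue α R g
  have hWV : ∀ s, |(W - V) s| ≤ α * η / (1 - α) := by
    refine abs_le_of_eq_smul_mulVec_add hα hR hR1 (E := fun s => α * ((R - Q) *ᵥ V) s) ?_ ?_
    · intro s
      have h1 : W s = _ := discountedValue_eq hα hR hR1 g s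
      have h2 : V s = _ := discountedValue_eq hα hQ hQ1 g s
      simp only [Pi.sub_apply, Matrix.mulVec_sub, Matrix.sub_mulVec]
      rw [h1, h2]
      ring
    · intro s
      rw [abs_mul, abs_of_pos hα.1]
      exact mul_le_mul_of_nonneg_left (hη s) hα.1.le
  have hb : 0 ≤ α * η / (1 - α) :=
    div_nonneg (mul_nonneg hα.1.le hη0) (sub_pos.2 hα.2).le
  rw [EuclideanSpace.norm_eq]
  calc √(∑ s, ‖(W - V) s‖ ^ 2) ≤ √(∑ _s : χ, (α * η / (1 - α)) ^ 2) := by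
        refine Real.sqrt_le_sqrt (Finset.sum_le_sum fun s _ => ?_)
        rw [Real.norm_eq_abs]
        exact pow_le_pow_left₀ (abs_nonneg _) (hWV s) 2
    _ = √(Fintype.card χ) * (α * η / (1 - α)) := by
        rw [Finset.sum_const, nsmul_eq_mul, Finset.card_univ, Real.sqrt_mul (Nat.cast_nonneg _),
          Real.sqrt_sq hb]

end DiscountedValue

/-! ### Policy matrices -/

section Policy

variable {χ I : Type*} [Fintype I] {π : χ → I → ℝ} {Q R : I → Matrix χ χ ℝ}

theorem policyMatrix_nonneg (hπ : ∀ s, π s ∈ stdSimplex ℝ I) (hQ : ∀ l s t, 0 ≤ Q l s t)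
    (s t : χ) : 0 ≤ policyMatrix π Q s t :=
  Finset.sum_nonneg fun l _ => mul_nonneg ((hπ s).1 l) (hQ l s t)

variable [Fintype χ]

theorem policyMatrix_mulVec (v : χ → ℝ) (s : χ) :
    (policyMatrix π Q *ᵥ v) s = ∑ l, π s l * (Q l *ᵥ v) s := by
  simp only [Matrix.mulVec, dotProduct, policyMatrix, Matrix.of_apply, Finset.sum_mul,
    Finset.mul_sum]
  rw [Finset.sum_comm]
  exact Finset.sum_congr rfl fun l _ => Finset.sum_congr rfl fun t _ => by ring

theorem policyMatrix_sum_row (s : χ) :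
    ∑ t, policyMatrix π Q s t = ∑ l, π s l * ∑ t, Q l s t := by
  simp only [policyMatrix, Matrix.of_apply, Finset.mul_sum]
  exact Finset.sum_comm

theorem policyMatrix_sum_row_le_one (hπ : ∀ s, π s ∈ stdSimplex ℝ I)
    (hQ : ∀ l s, ∑ t, Q l s t ≤ 1) (s : χ) : ∑ t, policyMatrix π Q s t ≤ 1 := by
  rw [policyMatrix_sum_row, ← (hπ s).2]
  exact Finset.sum_le_sum fun l _ => mul_le_of_le_one_right ((hπ s).1 l) (hQ l s)

theorem policyMatrix_mem_rowStochastic [DecidableEq χ] (hπ : ∀ s, π s ∈ stdSimplex ℝ I)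
    (hQ : ∀ l, Q l ∈ Matrix.rowStochastic ℝ χ) :
    policyMatrix π Q ∈ Matrix.rowStochastic ℝ χ := by
  refine Matrix.mem_rowStochastic_iff_sum.2 ⟨fun s t => policyMatrix_nonneg hπ
    (fun l s t => Matrix.nonneg_of_mem_rowStochastic (hQ l)) s t, fun s => ?_⟩
  rw [policyMatrix_sum_row, ← (hπ s).2]
  exact Finset.sum_congr rfl fun l _ => by
    rw [Matrix.sum_row_of_mem_rowStochastic (hQ l), mul_one]

/-- A bound for `(R l - Q l) v` that holds for all controls `l` passes to the policy matrices. -/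
theorem abs_policyMatrix_sub_mulVec_le (hπ : ∀ s, π s ∈ stdSimplex ℝ I) {v : χ → ℝ} {η : ℝ}
    (hη0 : 0 ≤ η) (s : χ) (h : ∀ l, |(R l *ᵥ v) s - (Q l *ᵥ v) s| ≤ η) :
    |((policyMatrix π R - policyMatrix π Q) *ᵥ v) s| ≤ η := by
  rw [Matrix.sub_mulVec, Pi.sub_apply, policyMatrix_mulVec, policyMatrix_mulVec,
    ← Finset.sum_sub_distrib]
  simp only [← mul_sub]
  exact abs_sum_mul_le (hπ s).1 (hπ s).2.le hη0 h

end Policy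

/-! ### Visits of a homogeneous Markov chain to a state -/

section Visits

variable {E : Type*} [Fintype E] [DecidableEq E]

/-- The expected number of visits to `w` during the steps `1, …, n` of the Markov chain with
transition matrix `K` started at `z`. -/
noncomputable def expectedVisits (K : Matrix E E ℝ) (w : E) (n : ℕ) (z : E) : ℝ :=
  ∑ r ∈ Finset.range n, (K ^ (r + 1)) z w

/-- The expectation of `(1 - c) ^ N`, where `N` is the number of visits to `w` during the steps
`1, …, n` of the Markov chain with transition matrix `K` started at `z`; defined by conditioning on
the first step. -/
noncomputable def discountedVisits (K : Matrix E E ℝ) (w : E) (c : ℝ) : ℕ → E → ℝ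
  | 0, _ => 1
  | n + 1, z => ∑ y, K z y * ((if y = w then 1 - c else 1) * discountedVisits K w c n y)

variable {K : Matrix E E ℝ} {w : E} {c : ℝ}

theorem pow_apply_nonneg (hK : K ∈ Matrix.rowStochastic ℝ E) (r : ℕ) (z y : E) :
    0 ≤ (K ^ r) z y :=
  Matrix.nonneg_of_mem_rowStochastic (pow_mem hK r)

theorem expectedVisits_nonneg (hK : K ∈ Matrix.rowStochastic ℝ E) (n : ℕ) (z : E) :
    0 ≤ expectedVisits K w n z :=
  Finset.sum_nonneg fun r _ => pow_apply_nonneg hK (r + 1) z w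

theorem sum_pow_mul_expectedVisits (r n : ℕ) (z : E) :
    ∑ y, (K ^ r) z y * expectedVisits K w n y
      = expectedVisits K w (r + n) z - expectedVisits K w r z := by
  rw [expectedVisits, expectedVisits, Finset.sum_range_add, add_sub_cancel_left]
  simp only [expectedVisits, Finset.mul_sum]
  rw [Finset.sum_comm]
  refine Finset.sum_congr rfl fun k _ => ?_
  rw [add_assoc, pow_add K r (k + 1), Matrix.mul_apply]

theorem discountedVisits_nonneg (hK : K ∈ Matrix.rowStochastic ℝ E) (hc1 : c ≤ 1) (n : ℕ) (z : E) :
    0 ≤ discountedVisits K w c n z := by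
  induction n generalizing z with
  | zero => exact zero_le_one
  | succ n ih =>
    refine Finset.sum_nonneg fun y _ =>
      mul_nonneg (Matrix.nonneg_of_mem_rowStochastic hK) (mul_nonneg ?_ (ih y))
    split_ifs <;> linarith

/-- The mean of `(1 - c) ^ N` decreases in `c`. -/
theorem discountedVisits_anti (hK : K ∈ Matrix.rowStochastic ℝ E) {c' : ℝ} (hcc : c' ≤ c)
    (hc1 : c ≤ 1) (n : ℕ) (z : E) :
    discountedVisits K w c n z ≤ discountedVisits K w c' n z := by
  induction n generalizing z with
  | zero => exact le_rfl
  | succ n ih =>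
    refine Finset.sum_le_sum fun y _ =>
      mul_le_mul_of_nonneg_left ?_ (Matrix.nonneg_of_mem_rowStochastic hK)
    refine mul_le_mul ?_ (ih y) (discountedVisits_nonneg hK hc1 n y) ?_ <;> split_ifs <;> linarith

/-- Decomposition of `1 - (1 - c) ^ N` over the visits to `w`, in expectation. -/
theorem discountedVisits_eq (hK : K ∈ Matrix.rowStochastic ℝ E) (n : ℕ) (z : E) :
    discountedVisits K w c n z
      = 1 - c * ∑ r ∈ Finset.range n, (K ^ (r + 1)) z w * discountedVisits K w c (n - 1 - r) w := by
  induction n generalizing z with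
  | zero => simp [discountedVisits]
  | succ n ih =>
    have h1 : discountedVisits K w c (n + 1) z
        = ∑ y, K z y * discountedVisits K w c n y - c * (K z w * discountedVisits K w c n w) := by
      have : ∀ y, K z y * ((if y = w then 1 - c else 1) * discountedVisits K w c n y)
          = K z y * discountedVisits K w c n y
            - if y = w then c * (K z y * discountedVisits K w c n y) else 0 := fun y => by
        split_ifs <;> ring
      simp only [discountedVisits, this, Finset.sum_sub_distrib, Finset.sum_ite_eq',
        Finset.mem_univ, if_true]
    have h2 : ∑ y, K z y * discountedVisits K w c n y
        = 1 - c * ∑ r ∈ Finset.range n,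
            (K ^ (r + 2)) z w * discountedVisits K w c (n - 1 - r) w := by
      simp only [ih, mul_sub, mul_one, Finset.sum_sub_distrib,
        Matrix.sum_row_of_mem_rowStochastic hK]
      congr 1
      simp only [Finset.mul_sum]
      rw [Finset.sum_comm]
      refine Finset.sum_congr rfl fun r _ => ?_
      rw [pow_succ' K (r + 1), Matrix.mul_apply, Finset.sum_mul, Finset.mul_sum]
      exact Finset.sum_congr rfl fun y _ => by ring
    rw [h1, h2, Finset.sum_range_succ']
    have h3 : ∑ r ∈ Finset.range n,
          (K ^ (r + 1 + 1)) z w * discountedVisits K w c (n + 1 - 1 - (r + 1)) w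
        = ∑ r ∈ Finset.range n, (K ^ (r + 2)) z w * discountedVisits K w c (n - 1 - r) w :=
      Finset.sum_congr rfl fun r _ => by rw [show n + 1 - 1 - (r + 1) = n - 1 - r by omega]
    rw [h3, zero_add, pow_one, Nat.add_sub_cancel, Nat.sub_zero]
    ring

theorem discountedVisits_le_one (hK : K ∈ Matrix.rowStochastic ℝ E) (hc0 : 0 ≤ c) (hc1 : c ≤ 1)
    (n : ℕ) (z : E) : discountedVisits K w c n z ≤ 1 := by
  rw [discountedVisits_eq hK]
  have := mul_nonneg hc0 (Finset.sum_nonneg (s := Finset.range n) fun r _ =>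
    mul_nonneg (pow_apply_nonneg hK (r + 1) z w)
      (discountedVisits_nonneg (w := w) hK hc1 (n - 1 - r) w))
  linarith

/-- Second-order upper bound for the mean of `(1 - c) ^ N`. -/
theorem discountedVisits_le (hK : K ∈ Matrix.rowStochastic ℝ E) (hc0 : 0 ≤ c) (hc1 : c ≤ 1)
    (n : ℕ) (z : E) :
    discountedVisits K w c n z ≤ 1 - c * expectedVisits K w n z
      + c ^ 2 * ∑ r ∈ Finset.range n, (K ^ (r + 1)) z w * expectedVisits K w (n - 1 - r) w := by
  have h1 : ∀ n z, 1 - c * expectedVisits K w n z ≤ discountedVisits K w c n z := fun n z => by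
    rw [discountedVisits_eq hK]
    refine sub_le_sub_left (mul_le_mul_of_nonneg_left ?_ hc0) 1
    exact Finset.sum_le_sum fun r _ => mul_le_of_le_one_right (pow_apply_nonneg hK _ _ _)
      (discountedVisits_le_one hK hc0 hc1 _ _)
  have h2 : ∑ r ∈ Finset.range n, (K ^ (r + 1)) z w * (1 - c * expectedVisits K w (n - 1 - r) w)
      ≤ ∑ r ∈ Finset.range n, (K ^ (r + 1)) z w * discountedVisits K w c (n - 1 - r) w :=
    Finset.sum_le_sum fun r _ => mul_le_mul_of_nonneg_left (h1 _ _) (pow_apply_nonneg hK _ _ _)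
  have h3 : ∑ r ∈ Finset.range n, (K ^ (r + 1)) z w * (1 - c * expectedVisits K w (n - 1 - r) w)
      = expectedVisits K w n z
        - c * ∑ r ∈ Finset.range n, (K ^ (r + 1)) z w * expectedVisits K w (n - 1 - r) w := by
    rw [expectedVisits, Finset.mul_sum, ← Finset.sum_sub_distrib]
    exact Finset.sum_congr rfl fun r _ => by ring
  rw [discountedVisits_eq hK]
  rw [h3] at h2
  have := mul_le_mul_of_nonneg_left h2 hc0
  linarith

/-! ### Visits under mixing and bounded return times -/

/-- The facts about a Markov chain with transition matrix `K` that force frequent visits to `w`.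
Here `R i` is the set of states that are possible at time `i ≥ 1`; the expected numbers of visits
to `w` from two possible states differ by at most `C`, the mean return times to `w` are at most `T`,
and visits to `w` are possible at times with gaps of at most `T`. -/
structure FrequentVisits (K : Matrix E E ℝ) (w : E) (R : ℕ → Set E) (C : ℝ) (T : ℕ) : Prop where
  stochastic : K ∈ Matrix.rowStochastic ℝ E
  nonneg : 0 ≤ C
  step : ∀ i ≥ 1, ∀ z y, z ∈ R i → K z y ≠ 0 → y ∈ R (i + 1)
  mixing : ∀ i ≥ 1, ∀ z ∈ R i, ∀ y ∈ R i, ∀ n,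
    expectedVisits K w n z ≤ expectedVisits K w n y + C
  renewal : ∀ i ≥ 1, w ∈ R i → ∀ n : ℕ, (n + 1 : ℝ) ≤ T * (1 + expectedVisits K w n w)
  gap : ∀ i ≥ 1, ∃ u < T, w ∈ R (i + u)

namespace FrequentVisits

variable {R : ℕ → Set E} {C : ℝ} {T : ℕ}

theorem mem_of_pow_ne_zero (h : FrequentVisits K w R C T) {i : ℕ} (hi : 1 ≤ i) {r : ℕ} {z y : E}
    (hz : z ∈ R i) (hy : (K ^ r) z y ≠ 0) : y ∈ R (i + r) := by
  induction r generalizing i z with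
  | zero =>
    rw [pow_zero, Matrix.one_apply] at hy
    obtain rfl : z = y := by
      by_contra hne
      exact hy (if_neg hne)
    exact hz
  | succ r ih =>
    rw [pow_succ', Matrix.mul_apply] at hy
    obtain ⟨x, -, hx⟩ := Finset.exists_ne_zero_of_sum_ne_zero hy
    have := ih (by omega) (h.step i hi z x hz (left_ne_zero_of_mul hx)) (right_ne_zero_of_mul hx)
    rwa [show i + (r + 1) = i + 1 + r by ring]

/-- From every possible state, `w` is visited at rate at least about `1 / T`. -/
theorem le_expectedVisits (h : FrequentVisits K w R C T) {i : ℕ} (hi : 1 ≤ i) {z : E}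
    (hz : z ∈ R i) (n : ℕ) : (n : ℝ) / T - 1 - C ≤ expectedVisits K w (n + T) z := by
  obtain ⟨u, hu, hw⟩ := h.gap i hi
  have hT : (0 : ℝ) < T := by exact_mod_cast (Nat.zero_le u).trans_lt hu
  obtain ⟨k, hk⟩ : ∃ k, n + T = u + (n + k) := ⟨T - u, by omega⟩
  -- by mixing, from every state possible at time `i + u` there are about as many visits as from `w`
  have h1 : ∀ y, (K ^ u) z y * ((n : ℝ) / T - 1 - C)
      ≤ (K ^ u) z y * expectedVisits K w (n + k) y := fun y => by
    by_cases hy : (K ^ u) z y = 0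
    · rw [hy, zero_mul, zero_mul]
    · refine mul_le_mul_of_nonneg_left ?_ (pow_apply_nonneg h.stochastic _ _ _)
      have h2 := h.mixing (i + u) (by omega) w hw y (h.mem_of_pow_ne_zero hi hz hy) (n + k)
      have h3 := h.renewal (i + u) (by omega) hw (n + k)
      have h4 : (n : ℝ) / T ≤ 1 + expectedVisits K w (n + k) w := by
        rw [div_le_iff₀ hT]
        push_cast at h3
        have : (0 : ℝ) ≤ k := Nat.cast_nonneg k
        linarith
      linarith
  have h5 := Finset.sum_le_sum fun y (_ : y ∈ Finset.univ) => h1 y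
  rw [← Finset.sum_mul, Matrix.sum_row_of_mem_rowStochastic (pow_mem h.stochastic u), one_mul,
    sum_pow_mul_expectedVisits, ← hk] at h5
  have := expectedVisits_nonneg (w := w) h.stochastic u z
  linarith

/-- The second moment of the number of visits, bounded through its mean: restarting at a visit to
`w` changes the expected number of later visits by at most `C`. -/
theorem sum_pow_mul_expectedVisits_le (h : FrequentVisits K w R C T) {i : ℕ} (hi : 1 ≤ i) {z : E}
    (hz : z ∈ R i) (n : ℕ) :
    ∑ r ∈ Finset.range n, (K ^ (r + 1)) z w * expectedVisits K w (n - 1 - r) w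
      ≤ expectedVisits K w n z * (expectedVisits K w n z + C) := by
  conv_rhs => enter [1]; rw [expectedVisits]
  rw [Finset.sum_mul]
  refine Finset.sum_le_sum fun r hr => ?_
  by_cases hy : (K ^ (r + 1)) z w = 0
  · rw [hy, zero_mul, zero_mul]
  refine mul_le_mul_of_nonneg_left ?_ (pow_apply_nonneg h.stochastic _ _ _)
  have hw := h.mem_of_pow_ne_zero hi hz hy
  have h1 : ∑ y, (K ^ (r + 1)) z y * expectedVisits K w (n - 1 - r) w
      ≤ ∑ y, (K ^ (r + 1)) z y * (expectedVisits K w (n - 1 - r) y + C) := by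
    refine Finset.sum_le_sum fun y _ => ?_
    by_cases hy : (K ^ (r + 1)) z y = 0
    · rw [hy, zero_mul, zero_mul]
    · exact mul_le_mul_of_nonneg_left (h.mixing _ (by omega) w hw y
        (h.mem_of_pow_ne_zero hi hz hy) _) (pow_apply_nonneg h.stochastic _ _ _)
  simp only [mul_add, Finset.sum_add_distrib] at h1
  rw [← Finset.sum_mul, ← Finset.sum_mul,
    Matrix.sum_row_of_mem_rowStochastic (pow_mem h.stochastic (r + 1)), one_mul, one_mul,
    sum_pow_mul_expectedVisits] at h1
  have h2 := expectedVisits_nonneg (w := w) h.stochastic (r + 1) z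
  have h3 : r + 1 + (n - 1 - r) = n := by
    have := Finset.mem_range.1 hr
    omega
  rw [h3] at h1
  linarith

/-- If the expected number of visits is at least `1 + C`, then the mean of `(1 - c) ^ N` is bounded
away from `1` already for `c` of order `1 / (1 + C)`. -/
theorem discountedVisits_le_of_le_expectedVisits (h : FrequentVisits K w R C T) {i : ℕ}
    (hi : 1 ≤ i) {z : E} (hz : z ∈ R i) {n : ℕ} (hn : 1 + C ≤ expectedVisits K w n z) :
    discountedVisits K w (1 / (2 * (1 + 2 * C))) n z ≤ 7 / 8 := by
  have hC := h.nonneg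
  set G := expectedVisits K w n z with hG
  have hpos : 0 < G + C := by linarith
  -- the weight for which the quadratic bound is optimal depends on `G`, hence on `z`
  have hc0 : 0 ≤ 1 / (2 * (G + C)) := by positivity
  have hcc : 1 / (2 * (G + C)) ≤ 1 / (2 * (1 + 2 * C)) :=
    one_div_le_one_div_of_le (by linarith) (by linarith)
  have hc1 : 1 / (2 * (1 + 2 * C)) ≤ 1 := by
    rw [div_le_one (by linarith)]
    linarith
  refine (discountedVisits_anti h.stochastic hcc hc1 n z).trans ?_
  refine (discountedVisits_le h.stochastic hc0 (hcc.trans hc1) n z).trans ?_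
  have h1 := mul_le_mul_of_nonneg_left (h.sum_pow_mul_expectedVisits_le hi hz n)
    (sq_nonneg (1 / (2 * (G + C))))
  rw [← hG] at h1 ⊢
  have h2 : 1 - 1 / (2 * (G + C)) * G + (1 / (2 * (G + C))) ^ 2 * (G * (G + C))
      = 1 - G / (4 * (G + C)) := by
    field_simp
    ring
  have h3 : 1 / 8 ≤ G / (4 * (G + C)) := by
    rw [le_div_iff₀ (by linarith)]
    linarith
  linarith

/-- Exponential decay of the mean of `(1 - c) ^ N` over successive blocks. -/
theorem discountedVisits_mul_le (h : FrequentVisits K w R C T) {L : ℕ} {q : ℝ} (hq : 0 ≤ q)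
    (hc1 : c ≤ 1) (hL : ∀ i ≥ 1, ∀ z ∈ R i, discountedVisits K w c L z ≤ q) (b : ℕ) {i : ℕ}
    (hi : 1 ≤ i) {z : E} (hz : z ∈ R i) : discountedVisits K w c (b * L) z ≤ q ^ b := by
  have key : ∀ n i, 1 ≤ i → ∀ z ∈ R i,
      discountedVisits K w c (n + L) z ≤ q * discountedVisits K w c n z := by
    intro n
    induction n with
    | zero =>
      intro i hi z hz
      simpa [discountedVisits] using hL i hi z hz
    | succ n ih =>
      intro i hi z hz
      rw [show n + 1 + L = n + L + 1 by ring, discountedVisits, discountedVisits, Finset.mul_sum]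
      refine Finset.sum_le_sum fun y _ => ?_
      by_cases hy : K z y = 0
      · simp [hy]
      have h1 := ih (i + 1) (by omega) y (h.step i hi z y hz hy)
      have h2 : (0 : ℝ) ≤ if y = w then 1 - c else 1 := by split_ifs <;> linarith
      have h3 := mul_le_mul_of_nonneg_left (mul_le_mul_of_nonneg_left h1 h2)
        (Matrix.nonneg_of_mem_rowStochastic h.stochastic (i := z) (j := y))
      linarith
  induction b with
  | zero => simp [discountedVisits]
  | succ b ih =>
    rw [Nat.succ_mul, pow_succ']
    exact (key _ i hi z hz).trans (mul_le_mul_of_nonneg_left ih hq)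

/-- The block length `T (3 + ⌈2 C⌉)` is long enough for `1 + C` expected visits. -/
theorem discountedVisits_block_le (h : FrequentVisits K w R C T) (b : ℕ) {i : ℕ} (hi : 1 ≤ i)
    {z : E} (hz : z ∈ R i) :
    discountedVisits K w (1 / (2 * (1 + 2 * C))) (b * (T * (3 + ⌈2 * C⌉₊))) z ≤ (7 / 8) ^ b := by
  have hC := h.nonneg
  have hT : (0 : ℝ) < T := by
    obtain ⟨u, hu, -⟩ := h.gap 1 le_rfl
    exact_mod_cast (Nat.zero_le u).trans_lt hu
  have hc1 : 1 / (2 * (1 + 2 * C)) ≤ 1 := by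
    rw [div_le_one (by linarith)]
    linarith
  refine h.discountedVisits_mul_le (by norm_num) hc1 (fun i hi z hz => ?_) b hi hz
  refine h.discountedVisits_le_of_le_expectedVisits hi hz ?_
  have h1 := h.le_expectedVisits hi hz (T * (2 + ⌈2 * C⌉₊))
  rw [show T * (2 + ⌈2 * C⌉₊) + T = T * (3 + ⌈2 * C⌉₊) by ring] at h1
  push_cast at h1
  rw [mul_div_cancel_left₀ _ hT.ne'] at h1
  have := Nat.le_ceil (2 * C)
  linarith

end FrequentVisits

end Visits

/-! ### Homogeneous finite Markov chains -/

section MarkovChain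

variable {Ω E : Type*} {mΩ : MeasurableSpace Ω}

/-- `Y` is a function of the values of the process `Z` at the times `0, …, i`. -/
def DependsOnPast {β : Type*} (Z : ℕ → Ω → E) (i : ℕ) (Y : Ω → β) : Prop :=
  ∀ ω ω', (∀ j ≤ i, Z j ω = Z j ω') → Y ω = Y ω'

theorem DependsOnPast.exists_eq {Z : ℕ → Ω → E} {i : ℕ} {Y : Ω → ℝ} (hY : DependsOnPast Z i Y) :
    ∃ φ : (Fin (i + 1) → E) → ℝ, ∀ ω, Y ω = φ fun j => Z j ω := by
  have h : Function.FactorsThrough Y (fun ω (j : Fin (i + 1)) => Z j ω) := fun ω ω' hω =>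
    hY ω ω' fun j hj => congrFun hω ⟨j, Nat.lt_succ_of_le hj⟩
  exact ⟨_, fun ω => (h.extend_apply 0 ω).symm⟩

/-- A function of a finite-valued random variable integrates to a finite sum. -/
theorem integral_comp_eq_sum {F : Type*} [Fintype F] [MeasurableSpace F]
    [MeasurableSingletonClass F] {μ : Measure Ω} [IsFiniteMeasure μ] {W : Ω → F}
    (hW : Measurable W) (f : F → ℝ) : ∫ ω, f (W ω) ∂μ = ∑ x, μ.real (W ⁻¹' {x}) * f x := by
  rw [← integral_map (φ := W) (f := f) hW.aemeasurable (Integrable.of_finite).aestronglyMeasurable,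
    integral_fintype Integrable.of_finite]
  refine Finset.sum_congr rfl fun x _ => ?_
  rw [smul_eq_mul, map_measureReal_apply hW (measurableSet_singleton x)]

variable [MeasurableSpace E]

/-- `Z` is a homogeneous Markov chain with transition matrix `K`: given the values up to time `i`,
the probability of going from the value at time `i` to `y` is given by `K`. -/
structure IsMarkovChain (μ : Measure Ω) (Z : ℕ → Ω → E) (K : Matrix E E ℝ) : Prop where
  measurable : ∀ i, Measurable (Z i)
  transition : ∀ (i : ℕ) (h : ℕ → E) (y : E),
    μ.real {ω | (∀ j ≤ i, Z j ω = h j) ∧ Z (i + 1) ω = y}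
      = μ.real {ω | ∀ j ≤ i, Z j ω = h j} * K (h i) y

variable [MeasurableSingletonClass E] {μ : Measure Ω} {Z : ℕ → Ω → E} {K : Matrix E E ℝ}

theorem DependsOnPast.integrable [Finite E] [IsFiniteMeasure μ] (hZ : ∀ i, Measurable (Z i)) {i : ℕ}
    {Y : Ω → ℝ} (hY : DependsOnPast Z i Y) : Integrable Y μ := by
  obtain ⟨φ, hφ⟩ := hY.exists_eq
  have hm : Measurable fun ω (j : Fin (i + 1)) => Z j ω := measurable_pi_lambda _ fun j => hZ j
  have : Integrable φ (μ.map fun ω (j : Fin (i + 1)) => Z j ω) := Integrable.of_finite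
  rw [show Y = φ ∘ fun ω (j : Fin (i + 1)) => Z j ω from funext hφ]
  exact this.comp_measurable hm

namespace IsMarkovChain

variable [Fintype E] [IsProbabilityMeasure μ]

/-- The Markov property for functions of the past. -/
theorem integral_mul_comp_succ (hZ : IsMarkovChain μ Z K) {i : ℕ} {Y : Ω → ℝ}
    (hY : DependsOnPast Z i Y) (ψ : E → ℝ) :
    ∫ ω, Y ω * ψ (Z (i + 1) ω) ∂μ = ∫ ω, Y ω * (K *ᵥ ψ) (Z i ω) ∂μ := by
  obtain ⟨φ, hφ⟩ := hY.exists_eq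
  have hm : Measurable fun ω (j : Fin (i + 1)) => Z j ω :=
    measurable_pi_lambda _ fun j => hZ.measurable j
  have h1 := integral_comp_eq_sum (μ := μ) (hm.prodMk (hZ.measurable (i + 1)))
    fun x => φ x.1 * ψ x.2
  have h2 := integral_comp_eq_sum (μ := μ) hm fun x => φ x * (K *ᵥ ψ) (x (Fin.last i))
  simp only [Fin.val_last] at h2
  simp only [hφ, h1, h2, Fintype.sum_prod_type]
  refine Finset.sum_congr rfl fun x _ => ?_
  rw [Matrix.mulVec, dotProduct, Finset.mul_sum, Finset.mul_sum]
  refine Finset.sum_congr rfl fun y _ => ?_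
  have h3 := hZ.transition i
    (fun j => if hj : j < i + 1 then x ⟨j, hj⟩ else x 0) y
  have h4 : {ω | ∀ j ≤ i, Z j ω = if hj : j < i + 1 then x ⟨j, hj⟩ else x 0}
      = (fun ω (j : Fin (i + 1)) => Z j ω) ⁻¹' {x} := by
    ext ω
    simp only [Set.mem_ofPred_eq, Set.mem_preimage, Set.mem_singleton_iff, funext_iff]
    constructor
    · intro h j
      rw [h j (Nat.lt_succ_iff.1 j.2), dif_pos j.2]
    · intro h j hj
      rw [dif_pos (Nat.lt_succ_of_le hj)]
      exact h ⟨j, Nat.lt_succ_of_le hj⟩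
  have h5 : (fun ω => ((fun (j : Fin (i + 1)) => Z j ω), Z (i + 1) ω)) ⁻¹' {(x, y)}
      = {ω | (∀ j ≤ i, Z j ω = if hj : j < i + 1 then x ⟨j, hj⟩ else x 0) ∧ Z (i + 1) ω = y} := by
    rw [Set.ofPred_and, h4]
    ext ω
    simp [Prod.ext_iff]
  rw [h5, h3, h4, dif_pos (Nat.lt_succ_self i)]
  simp only [Fin.last]
  ring

variable [DecidableEq E]

theorem integral_indicator_mul_comp_add (hZ : IsMarkovChain μ Z K) (i n : ℕ) (z : E) (ψ : E → ℝ) :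
    ∫ ω, (if Z i ω = z then 1 else 0) * ψ (Z (i + n) ω) ∂μ
      = μ.real {ω | Z i ω = z} * ((K ^ n) *ᵥ ψ) z := by
  induction n generalizing ψ with
  | zero =>
    have h1 := integral_comp_eq_sum (μ := μ) (hZ.measurable i) fun x =>
      (if x = z then 1 else 0) * ψ x
    simp only [add_zero, pow_zero, Matrix.one_mulVec]
    rw [h1, Finset.sum_eq_single z (fun x _ hx => by simp [hx]) (by simp)]
    simp only [if_true, one_mul]
    rfl
  | succ n ih =>
    have h : DependsOnPast Z (i + n) fun ω => if Z i ω = z then (1 : ℝ) else 0 :=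
      fun ω ω' hω => by simp only [hω i (Nat.le_add_right i n)]
    rw [← add_assoc, hZ.integral_mul_comp_succ h, ih, pow_succ, ← Matrix.mulVec_mulVec]

/-- The `n`-step transition probabilities. -/
theorem measureReal_inter_add (hZ : IsMarkovChain μ Z K) (i n : ℕ) (z y : E) :
    μ.real {ω | Z i ω = z ∧ Z (i + n) ω = y} = μ.real {ω | Z i ω = z} * (K ^ n) z y := by
  have h := hZ.integral_indicator_mul_comp_add i n z (Pi.single y 1)
  rw [Matrix.mulVec_single_one] at h
  rw [Matrix.col_apply] at h
  rw [← h]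
  have hm : MeasurableSet {ω | Z i ω = z ∧ Z (i + n) ω = y} :=
    (hZ.measurable i (measurableSet_singleton z)).inter
      (hZ.measurable (i + n) (measurableSet_singleton y))
  rw [← integral_indicator_one hm]
  refine integral_congr_ae (ae_of_all _ fun ω => ?_)
  by_cases h1 : Z i ω = z <;> by_cases h2 : Z (i + n) ω = y <;>
    simp [Set.indicator, h1, h2]

theorem possible_succ (hZ : IsMarkovChain μ Z K) {i : ℕ} {z y : E}
    (hz : μ.real {ω | Z i ω = z} ≠ 0) (hy : K z y ≠ 0) : μ.real {ω | Z (i + 1) ω = y} ≠ 0 := by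
  have h := hZ.measureReal_inter_add i 1 z y
  rw [pow_one] at h
  intro h0
  have : μ.real {ω | Z i ω = z ∧ Z (i + 1) ω = y} = 0 :=
    le_antisymm ((measureReal_mono fun ω hω => hω.2).trans h0.le) measureReal_nonneg
  exact mul_ne_zero hz hy (h ▸ this)

/-- The mean of `(1 - c) ^ N`, where `N` is the number of visits to `w` at the times
`2, …, n + 1`, is an average of the values for fixed states at time `1`. -/
theorem integral_pow_card_visits (hZ : IsMarkovChain μ Z K) (w : E) (c : ℝ) (n : ℕ) :
    ∫ ω, (1 - c) ^ ((Finset.Icc 2 (n + 1)).filter fun i => Z i ω = w).card ∂μ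
      = ∫ ω, discountedVisits K w c n (Z 1 ω) ∂μ := by
  have key : ∀ k r, ∫ ω, (1 - c) ^ ((Finset.Icc 2 (k + 1)).filter fun i => Z i ω = w).card
        * discountedVisits K w c r (Z (k + 1) ω) ∂μ
      = ∫ ω, discountedVisits K w c (k + r) (Z 1 ω) ∂μ := by
    intro k
    induction k with
    | zero => intro r; simp
    | succ k ih =>
      intro r
      rw [show k + 1 + r = k + (r + 1) by ring, ← ih (r + 1)]
      have hY : DependsOnPast Z (k + 1) fun ω =>
          (1 - c) ^ ((Finset.Icc 2 (k + 1)).filter fun i => Z i ω = w).card := fun ω ω' hω => by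
        have : (Finset.Icc 2 (k + 1)).filter (fun i => Z i ω = w)
            = (Finset.Icc 2 (k + 1)).filter fun i => Z i ω' = w :=
          Finset.filter_congr fun i hi => by rw [hω i (Finset.mem_Icc.1 hi).2]
        simp only [this]
      have h := hZ.integral_mul_comp_succ hY fun y =>
        (if y = w then 1 - c else 1) * discountedVisits K w c r y
      refine Eq.trans ?_ h
      refine integral_congr_ae (ae_of_all _ fun ω => ?_)
      have h1 : Finset.Icc 2 (k + 1 + 1) = insert (k + 1 + 1) (Finset.Icc 2 (k + 1)) :=
        (Finset.insert_Icc_right_eq_Icc_add_one (by omega)).symm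
      simp only [h1, Finset.filter_insert]
      split_ifs
      · rw [Finset.card_insert_of_notMem (by simp)]
        ring
      · ring
  simpa [discountedVisits] using key n 0

end IsMarkovChain

/-! ### Return times of a Markov chain -/

/-- The event that `Z` does not visit `w` during the `u` steps after time `t`. -/
def noVisit (Z : ℕ → Ω → E) (w : E) (t u : ℕ) : Set Ω :=
  {ω | ∀ v, t < v → v ≤ t + u → Z v ω ≠ w}

/-- From a visit to `w`, and from time `0`, the mean time to the next visit to `w` is at most `T`,
whatever happened before; the mean is written as the sum of the tail probabilities. -/
def HasReturnTail (μ : Measure Ω) (ℱ : Filtration ℕ mΩ) (Z : ℕ → Ω → E)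
    (w : E) (T : ℕ) : Prop :=
  ∀ (t : ℕ) (A : Set Ω), MeasurableSet[ℱ t] A → (t = 0 ∨ ∀ ω ∈ A, Z t ω = w) →
    ∀ n, ∑ u ∈ Finset.range n, μ.real (A ∩ noVisit Z w t u) ≤ T * μ.real A

namespace HasReturnTail

variable {ℱ : Filtration ℕ mΩ} [IsProbabilityMeasure μ] {w : E} {T : ℕ}

/-- Renewal inequality, from the decomposition of `n + 1` time points according to the last visit
to `w`. -/
theorem le_mul_one_add_expectedVisits [Fintype E] [DecidableEq E]
    (h : HasReturnTail μ ℱ Z w T)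
    (hℱ : Adapted ℱ Z) (hZ : IsMarkovChain μ Z K) {t : ℕ} (hw : μ.real {ω | Z t ω = w} ≠ 0)
    (n : ℕ) : (n + 1 : ℝ) ≤ T * (1 + expectedVisits K w n w) := by
  set p := μ.real {ω | Z t ω = w} with hp
  have hp0 : 0 < p := lt_of_le_of_ne measureReal_nonneg hw.symm
  set A : ℕ → Set Ω := fun i => {ω | Z t ω = w ∧ Z (t + i) ω = w} with hA
  have h1 : ∀ i, ∑ u ∈ Finset.range (n + 1 - i), μ.real (A i ∩ noVisit Z w (t + i) u)
      ≤ T * (p * (K ^ i) w w) := fun i => by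
    rw [← hZ.measureReal_inter_add t i w w]
    refine h (t + i) (A i) ?_ (Or.inr fun ω hω => hω.2) _
    exact (ℱ.mono (Nat.le_add_right t i) _ (hℱ t (measurableSet_singleton w))).inter
      (hℱ (t + i) (measurableSet_singleton w))
  have h2 : ∀ v, p ≤ ∑ i ∈ Finset.range (v + 1), μ.real (A i ∩ noVisit Z w (t + i) (v - i)) := by
    intro v
    refine le_trans (measureReal_mono ?_ (measure_ne_top μ _)) (measureReal_biUnion_finset_le _ _)
    intro ω hω
    have hne : ((Finset.range (v + 1)).filter fun i => Z (t + i) ω = w).Nonempty :=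
      ⟨0, by simpa using hω⟩
    obtain ⟨i, hi, hmax⟩ := Finset.exists_max_image _ id hne
    rw [Finset.mem_filter, Finset.mem_range] at hi
    refine Set.mem_biUnion (Finset.mem_coe.2 (Finset.mem_range.2 hi.1)) ⟨⟨hω, hi.2⟩, ?_⟩
    intro r hr hrv hrw
    have := hmax (r - t) (Finset.mem_filter.2 ⟨Finset.mem_range.2 (by omega), by
      rwa [show t + (r - t) = r by omega]⟩)
    simp only [id] at this
    omega
  have h3 := Finset.sum_le_sum fun v (_ : v ∈ Finset.range (n + 1)) => h2 v
  rw [Finset.sum_range_diag_flip (n + 1)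
    fun i u => μ.real (A i ∩ noVisit Z w (t + i) u)] at h3
  have h4 := h3.trans (Finset.sum_le_sum fun i (_ : i ∈ Finset.range (n + 1)) => h1 i)
  rw [Finset.sum_const, Finset.card_range, nsmul_eq_mul, ← Finset.mul_sum, ← Finset.mul_sum,
    Finset.sum_range_succ', pow_zero, Matrix.one_apply_eq] at h4
  change _ ≤ (T : ℝ) * (p * (expectedVisits K w n w + 1)) at h4
  push_cast at h4
  nlinarith

/-- Within `T` steps after time `0`, or after a time at which a visit to `w` is possible, a visit to
`w` is possible: otherwise the first `T + 1` tail probabilities of the return time would be `1`. -/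
theorem exists_possible (h : HasReturnTail μ ℱ Z w T) (hℱ : Adapted ℱ Z) {t : ℕ}
    (ht : t = 0 ∨ μ.real {ω | Z t ω = w} ≠ 0) :
    ∃ v < T, μ.real {ω | Z (t + 1 + v) ω = w} ≠ 0 := by
  obtain ⟨A, hA, hA0, hAw⟩ : ∃ A : Set Ω, MeasurableSet[ℱ t] A ∧ μ.real A ≠ 0 ∧
      (t = 0 ∨ ∀ ω ∈ A, Z t ω = w) := by
    rcases ht with ht | ht
    · exact ⟨Set.univ, MeasurableSet.univ, by simp, Or.inl ht⟩
    · exact ⟨_, hℱ t (measurableSet_singleton w), ht, Or.inr fun ω hω => hω⟩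
  by_contra! hcon
  have h1 : ∀ u ∈ Finset.range (T + 1), μ.real (A ∩ noVisit Z w t u) = μ.real A := fun u hu => by
    refine measureReal_congr ?_
    have h2 : ∀ᵐ ω ∂μ, ∀ v < T, Z (t + 1 + v) ω ≠ w := by
      rw [ae_all_iff]
      intro v
      by_cases hv : v < T
      · have h3 := hcon v hv
        rw [measureReal_eq_zero_iff] at h3
        filter_upwards [compl_mem_ae_iff.2 h3] with ω hω _ using hω
      · exact ae_of_all _ fun ω h => absurd h hv
    filter_upwards [h2] with ω hω
    refine propext ⟨fun h => h.1, fun h => ⟨h, fun v hv hvu => ?_⟩⟩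
    have := hω (v - (t + 1)) (by have := Finset.mem_range.1 hu; omega)
    rwa [show t + 1 + (v - (t + 1)) = v by omega] at this
  have h2 := h t A hA hAw (T + 1)
  rw [Finset.sum_congr rfl h1, Finset.sum_const, Finset.card_range, nsmul_eq_mul] at h2
  push_cast at h2
  have : 0 < μ.real A := lt_of_le_of_ne measureReal_nonneg hA0.symm
  linarith

/-- Visits to `w` are possible at times with gaps of at most `T`. -/
theorem exists_possible_of_one_le (h : HasReturnTail μ ℱ Z w T) (hℱ : Adapted ℱ Z) {i : ℕ}
    (hi : 1 ≤ i) :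
    ∃ u < T, μ.real {ω | Z (i + u) ω = w} ≠ 0 := by
  induction i, hi using Nat.le_induction with
  | base => simpa using h.exists_possible hℱ (Or.inl rfl)
  | succ i hi ih =>
    obtain ⟨u, hu, hw⟩ := ih
    rcases u with _ | u
    · exact h.exists_possible hℱ (Or.inr hw)
    · exact ⟨u, by omega, by rwa [show i + 1 + u = i + (u + 1) by ring]⟩

end HasReturnTail

end MarkovChain

/-! ### The state-control process as a Markov chain -/

section Pair

variable {Ω χ I : Type*}

/-- The process of state-control pairs. -/
def pairProcess (X : ℕ → Ω → χ) (a : ℕ → Ω → I) (i : ℕ) (ω : Ω) : χ × I := (X i ω, a i ω)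

/-- Transition matrix of the state-control pairs: the state moves according to `M`, then the control
is drawn from `P`. -/
def jointMatrix (M : I → Matrix χ χ ℝ) (P : χ → I → ℝ) : Matrix (χ × I) (χ × I) ℝ :=
  Matrix.of fun z y => M z.2 z.1 y.1 * P y.1 y.2

variable {mΩ : MeasurableSpace Ω} {μ : Measure Ω} {ℱ : Filtration ℕ mΩ}
  {X : ℕ → Ω → χ} {a : ℕ → Ω → I}

theorem measureReal_cond {A : Set Ω} (hA : MeasurableSet A) (μ : Measure Ω) (B : Set Ω) :
    (μ[|A]).real B = (μ.real A)⁻¹ * μ.real (A ∩ B) := by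
  rw [measureReal_def, cond_apply hA, ENNReal.toReal_mul, ENNReal.toReal_inv, measureReal_def,
    measureReal_def]

theorem adapted_pairProcess [MeasurableSpace χ] [MeasurableSpace I] (hX : Adapted ℱ X)
    (ha : Adapted ℱ a) : Adapted ℱ (pairProcess X a) :=
  fun i => (hX i).prodMk (ha i)

theorem jointMatrix_mulVec_comp_fst [Fintype χ] [Fintype I] {M : I → Matrix χ χ ℝ} {P : χ → I → ℝ}
    (hP : ∀ s, P s ∈ stdSimplex ℝ I) (f : χ → ℝ) (z : χ × I) :
    (jointMatrix M P *ᵥ fun y => f y.1) z = (M z.2 *ᵥ f) z.1 := by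
  simp only [Matrix.mulVec, dotProduct, jointMatrix, Matrix.of_apply, Fintype.sum_prod_type]
  refine Finset.sum_congr rfl fun t _ => ?_
  rw [← Finset.sum_mul, ← Finset.mul_sum, (hP t).2, mul_one]

variable [Fintype χ] [DecidableEq χ] {M : I → Matrix χ χ ℝ} {P : χ → I → ℝ}

theorem jointMatrix_mem_rowStochastic [Fintype I] [DecidableEq I]
    (hM : ∀ l, M l ∈ Matrix.rowStochastic ℝ χ) (hP : ∀ s, P s ∈ stdSimplex ℝ I) :
    jointMatrix M P ∈ Matrix.rowStochastic ℝ (χ × I) := by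
  refine Matrix.mem_rowStochastic_iff_sum.2 ⟨fun z y => mul_nonneg
    (Matrix.nonneg_of_mem_rowStochastic (hM z.2)) ((hP y.1).1 y.2), fun z => ?_⟩
  simp only [jointMatrix, Matrix.of_apply, Fintype.sum_prod_type, ← Finset.mul_sum, (hP _).2,
    mul_one, Matrix.sum_row_of_mem_rowStochastic (hM z.2)]

theorem jointMatrix_pow_succ_apply [Fintype I] [DecidableEq I] (r : ℕ) (z : χ × I) (s : χ) (l : I) :
    (jointMatrix M P ^ (r + 1)) z (s, l)
      = (∑ y, (jointMatrix M P ^ r) z y * M y.2 y.1 s) * P s l := by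
  rw [pow_succ, Matrix.mul_apply, Finset.sum_mul]
  exact Finset.sum_congr rfl fun y _ => (mul_assoc _ _ _).symm

variable [MeasurableSpace χ] [MeasurableSpace I]

variable [IsProbabilityMeasure μ] [MeasurableSingletonClass χ] [MeasurableSingletonClass I]

theorem IsControlledMarkovChain.isMarkovChain (h : IsControlledMarkovChain μ ℱ X a M)
    (hP0 : ∀ i, 1 ≤ i → ∀ s (h : ℕ → χ × I),
      μ ({ω | X i ω = s} ∩ historyEvent X a i h) ≠ 0 →
      ∀ l : I, (μ[|{ω | X i ω = s} ∩ historyEvent X a i h]).real {ω | a i ω = l} = P s l) :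
    IsMarkovChain μ (pairProcess X a) (jointMatrix M P) where
  measurable i := (adapted_pairProcess h.adapted_state h.adapted_control i).mono (ℱ.le i) le_rfl
  transition i hist y := by
    obtain ⟨t, l⟩ := y
    set H := {ω | ∀ j ≤ i, pairProcess X a j ω = hist j} with hH
    have hXm : ∀ j, Measurable (X j) := fun j => (h.adapted_state j).mono (ℱ.le j) le_rfl
    have hHm : MeasurableSet[ℱ i] H := by
      have : H = ⋂ j ∈ Set.Iic i, pairProcess X a j ⁻¹' {hist j} := by
        ext ω
        simp [hH]
      rw [this]
      exact MeasurableSet.biInter (Set.to_countable _) fun j hj => ℱ.mono hj _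
        (adapted_pairProcess h.adapted_state h.adapted_control j (measurableSet_singleton _))
    have hXt : MeasurableSet {ω | X (i + 1) ω = t} := hXm (i + 1) (measurableSet_singleton t)
    -- the state moves according to `M`
    have h1 : μ.real ({ω | X (i + 1) ω = t} ∩ H) = μ.real H * M (hist i).2 (hist i).1 t := by
      have h2 : ∫ ω in H, (μ[{ω | X (i + 1) ω = t}.indicator (fun _ => (1 : ℝ)) | ℱ i]) ω ∂μ = _ :=
        setIntegral_condExp (ℱ.le i) ((integrable_const (1 : ℝ)).indicator hXt) hHm
      rw [setIntegral_congr_ae (g := fun _ => M (hist i).2 (hist i).1 t) (ℱ.le i _ hHm),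
        setIntegral_const, smul_eq_mul, setIntegral_indicator hXt, setIntegral_const, smul_eq_mul,
        mul_one] at h2
      · rw [h2, Set.inter_comm]
      · filter_upwards [h.transition i t] with ω hω hωH
        have h3 : (X i ω, a i ω) = hist i := hωH i le_rfl
        rw [hω, ← h3]
    have hhist : historyEvent X a (i + 1) hist = H := by
      ext ω
      simp only [historyEvent, hH, Set.mem_ofPred_eq, Nat.lt_succ_iff, pairProcess]
    have hset : {ω | (∀ j ≤ i, pairProcess X a j ω = hist j) ∧ pairProcess X a (i + 1) ω = (t, l)}
        = ({ω | X (i + 1) ω = t} ∩ H) ∩ {ω | a (i + 1) ω = l} := by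
      ext ω
      simp only [hH, Set.mem_inter_iff, Set.mem_ofPred_eq, pairProcess, Prod.mk.injEq]
      tauto
    rw [hset, jointMatrix, Matrix.of_apply, ← mul_assoc, ← h1]
    -- the control is drawn from `P`
    by_cases h0 : μ ({ω | X (i + 1) ω = t} ∩ H) = 0
    · rw [measureReal_def, measureReal_def, h0, measure_mono_null Set.inter_subset_left h0]
      simp
    · have h2 := hP0 (i + 1) (Nat.le_add_left 1 i) t hist (by rwa [hhist]) l
      rw [hhist, measureReal_cond (hXt.inter (ℱ.le i _ hHm))] at h2
      rw [← h2, mul_inv_cancel_left₀]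
      rw [measureReal_def]
      exact (ENNReal.toReal_pos h0 (measure_ne_top μ _)).ne'

end Pair

/-! ### Mixing -/

section Mixing

variable {Ω χ I : Type*} [MeasurableSpace χ]

theorem abs_sub_le_tvDist [Finite χ] (ν₁ ν₂ : Measure χ) (A : Set χ) :
    |ν₁.real A - ν₂.real A| ≤ tvDist ν₁ ν₂ :=
  le_ciSup (f := fun A : Set χ => |ν₁.real A - ν₂.real A|) (Set.finite_range _).bddAbove A

variable {mΩ : MeasurableSpace Ω} {μ : Measure Ω} {X : ℕ → Ω → χ} {a : ℕ → Ω → I}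

theorem thetaBar_nonneg (i j : ℕ) : 0 ≤ thetaBar μ X a i j := by
  refine Real.sSup_nonneg ?_
  rintro _ ⟨s₁, l₁, s₂, l₂, -, -, -, rfl⟩
  exact Real.iSup_nonneg fun _ => abs_nonneg _

theorem tvDist_le_thetaBar [Finite χ] [Finite I] {i : ℕ} {s₁ s₂ : χ} {l₁ l₂ : I}
    (hne : (s₁, l₁) ≠ (s₂, l₂)) (h₁ : μ {ω | X i ω = s₁ ∧ a i ω = l₁} ≠ 0)
    (h₂ : μ {ω | X i ω = s₂ ∧ a i ω = l₂} ≠ 0) (j : ℕ) :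
    tvDist ((μ[|{ω | X i ω = s₁ ∧ a i ω = l₁}]).map (X j))
      ((μ[|{ω | X i ω = s₂ ∧ a i ω = l₂}]).map (X j)) ≤ thetaBar μ X a i j := by
  refine le_csSup (Set.Finite.bddAbove ?_) ⟨s₁, l₁, s₂, l₂, hne, h₁, h₂, rfl⟩
  refine (Set.finite_range fun q : (χ × I) × (χ × I) =>
    tvDist ((μ[|{ω | X i ω = q.1.1 ∧ a i ω = q.1.2}]).map (X j))
      ((μ[|{ω | X i ω = q.2.1 ∧ a i ω = q.2.2}]).map (X j))).subset ?_
  rintro r ⟨s₁, l₁, s₂, l₂, -, -, -, rfl⟩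
  exact ⟨((s₁, l₁), (s₂, l₂)), rfl⟩

/-- Without two different state-control pairs, the mixing coefficients vanish. -/
theorem thetaBar_eq_zero [Subsingleton (χ × I)] (i j : ℕ) : thetaBar μ X a i j = 0 := by
  have : {r : ℝ | ∃ (s₁ : χ) (l₁ : I) (s₂ : χ) (l₂ : I), (s₁, l₁) ≠ (s₂, l₂) ∧
    μ {ω | X i ω = s₁ ∧ a i ω = l₁} ≠ 0 ∧ μ {ω | X i ω = s₂ ∧ a i ω = l₂} ≠ 0 ∧
    r = tvDist ((μ[|{ω | X i ω = s₁ ∧ a i ω = l₁}]).map (X j))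
      ((μ[|{ω | X i ω = s₂ ∧ a i ω = l₂}]).map (X j))} = ∅ := by
    refine Set.eq_empty_iff_forall_notMem.2 ?_
    rintro r ⟨s₁, l₁, s₂, l₂, hne, -⟩
    exact hne (Subsingleton.elim _ _)
  rw [thetaBar, this, Real.sSup_empty]

variable [Fintype χ] [Fintype I] [DecidableEq χ] [DecidableEq I] [MeasurableSpace I]
  [MeasurableSingletonClass χ] [MeasurableSingletonClass I] [IsProbabilityMeasure μ]
  {M : I → Matrix χ χ ℝ} {P : χ → I → ℝ}

/-- The law of a later state given the pair at time `i`, through the transition matrix. -/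
theorem real_map_cond_singleton (hZ : IsMarkovChain μ (pairProcess X a) (jointMatrix M P))
    (hP : ∀ s, P s ∈ stdSimplex ℝ I) {i : ℕ} {s : χ} {l : I}
    (h0 : μ {ω | X i ω = s ∧ a i ω = l} ≠ 0) (r : ℕ) (t : χ) :
    ((μ[|{ω | X i ω = s ∧ a i ω = l}]).map (X (i + (r + 1)))).real {t}
      = ∑ y, (jointMatrix M P ^ r) (s, l) y * M y.2 y.1 t := by
  have hXm : ∀ j, Measurable (X j) := fun j => measurable_fst.comp (hZ.measurable j)
  have hset : {ω | X i ω = s ∧ a i ω = l} = {ω | pairProcess X a i ω = (s, l)} := by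
    ext ω
    simp [pairProcess]
  have hpos : μ.real {ω | pairProcess X a i ω = (s, l)} ≠ 0 := by
    rw [← hset, measureReal_def]
    exact (ENNReal.toReal_pos h0 (measure_ne_top μ _)).ne'
  have hm : MeasurableSet {ω | pairProcess X a i ω = (s, l)} :=
    hZ.measurable i (measurableSet_singleton _)
  rw [map_measureReal_apply (hXm _) (measurableSet_singleton t), hset, measureReal_cond hm,
    inv_mul_eq_iff_eq_mul₀ hpos]
  have hunion : {ω | pairProcess X a i ω = (s, l)} ∩ X (i + (r + 1)) ⁻¹' {t}
      = ⋃ k ∈ (Finset.univ : Finset I),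
        {ω | pairProcess X a i ω = (s, l) ∧ pairProcess X a (i + (r + 1)) ω = (t, k)} := by
    ext ω
    simp [pairProcess]
  rw [hunion, measureReal_biUnion_finset]
  · simp only [hZ.measureReal_inter_add, jointMatrix_pow_succ_apply]
    rw [← Finset.mul_sum, ← Finset.mul_sum, (hP t).2, mul_one]
  · intro k _ k' _ hkk
    refine Set.disjoint_left.2 fun ω h1 h2 => hkk ?_
    have := h1.2.symm.trans h2.2
    exact (Prod.ext_iff.1 this).2
  · exact fun k _ => hm.inter (hZ.measurable _ (measurableSet_singleton _))

/-- Mixing of the states bounds the difference of the expected numbers of visits to a state-control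
pair from two pairs that are possible at the same time. -/
theorem expectedVisits_le_add (hZ : IsMarkovChain μ (pairProcess X a) (jointMatrix M P))
    (hP : ∀ s, P s ∈ stdSimplex ℝ I) {C : ℝ} (hmix : StateMixing μ X a C) {i : ℕ} (hi : 1 ≤ i)
    (w : χ × I) {z y : χ × I} (hz : μ.real {ω | pairProcess X a i ω = z} ≠ 0)
    (hy : μ.real {ω | pairProcess X a i ω = y} ≠ 0) (n : ℕ) :
    expectedVisits (jointMatrix M P) w n z ≤ expectedVisits (jointMatrix M P) w n y + C := by
  by_cases hzy : z = y
  · rw [hzy]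
    linarith [hmix.1]
  have hpos : ∀ z, μ.real {ω | pairProcess X a i ω = z} ≠ 0 →
      μ {ω | X i ω = z.1 ∧ a i ω = z.2} ≠ 0 := fun z hz h0 => by
    refine hz ?_
    rw [measureReal_def, show {ω | pairProcess X a i ω = z} = {ω | X i ω = z.1 ∧ a i ω = z.2} by
      ext ω; simp [pairProcess, Prod.ext_iff], h0, ENNReal.toReal_zero]
  have h1 : ∀ r, (jointMatrix M P ^ (r + 1)) z w - (jointMatrix M P ^ (r + 1)) y w
      ≤ thetaBar μ X a i (i + 1 + r) := fun r => by
    have h2 := (abs_sub_le_tvDist _ _ {w.1}).trans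
      (tvDist_le_thetaBar (X := X) (a := a) (j := i + (r + 1)) (by simpa [Prod.ext_iff] using hzy)
        (hpos z hz) (hpos y hy))
    rw [real_map_cond_singleton hZ hP (hpos z hz), real_map_cond_singleton hZ hP (hpos y hy),
      ← add_assoc, add_right_comm] at h2
    have h3 : P w.1 w.2 ≤ 1 := by
      rw [← (hP w.1).2]
      exact Finset.single_le_sum (fun l _ => (hP w.1).1 l) (Finset.mem_univ w.2)
    rw [← Prod.mk.eta (p := w), jointMatrix_pow_succ_apply, jointMatrix_pow_succ_apply, ← sub_mul]
    refine (le_abs_self _).trans ?_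
    rw [abs_mul, abs_of_nonneg ((hP w.1).1 w.2)]
    exact (mul_le_of_le_one_right (abs_nonneg _) h3).trans h2
  rw [← sub_le_iff_le_add', expectedVisits, expectedVisits, ← Finset.sum_sub_distrib]
  exact (Finset.sum_le_sum fun r _ => h1 r).trans
    (((hmix.2 i hi).1.sum_le_tsum _ fun r _ => thetaBar_nonneg _ _).trans (hmix.2 i hi).2)

end Mixing

/-! ### Return times -/

section VisitTime

variable {Ω χ I : Type*} {X : ℕ → Ω → χ} {a : ℕ → Ω → I} {s : χ} {l : I} {ω : Ω}

theorem visitTime_le_succ (i : ℕ) : visitTime X a s l i ω ≤ visitTime X a s l (i + 1) ω := by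
  rw [visitTime]
  exact le_iInf₂ fun n hn => hn.1.le

theorem visitTime_lt_of_lt {i j t : ℕ} (hi : visitTime X a s l i ω = t) (hij : i < j) :
    (t : ℕ∞) < visitTime X a s l j ω := by
  have h1 : (t : ℕ∞) < visitTime X a s l (i + 1) ω := by
    rw [← not_le, visitTime_succ_le_iff]
    rintro ⟨k, hk, hlt, -⟩
    rw [hi] at hlt
    exact absurd hk (not_le.2 (by exact_mod_cast hlt))
  exact h1.trans_le (monotone_nat_of_le_succ (f := fun i => visitTime X a s l i ω)
    (fun i => visitTime_le_succ i) hij)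

theorem le_of_visitTime_le {i n : ℕ} (h : visitTime X a s l i ω ≤ n) : i ≤ n := by
  induction i generalizing n with
  | zero => exact Nat.zero_le n
  | succ i ih =>
    obtain ⟨k, hk, hlt, -⟩ := (visitTime_succ_le_iff X a s l i n ω).1 h
    have h0 : k ≠ 0 := by
      rintro rfl
      simp at hlt
    have : visitTime X a s l i ω ≤ (k - 1 : ℕ) := by
      refine ENat.lt_add_one_iff (by simp) |>.1 ?_
      rwa [show ((k - 1 : ℕ) : ℕ∞) + 1 = k by exact_mod_cast Nat.sub_add_cancel (by omega)]
    have := ih this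
    omega

/-- Every time at which `(s, l)` is visited is a visit time; time `0` always is. -/
theorem exists_visitTime_eq {t : ℕ} (h : t = 0 ∨ pairProcess X a t ω = (s, l)) :
    ∃ i, visitTime X a s l i ω = t := by
  rcases Nat.eq_zero_or_pos t with rfl | ht
  · exact ⟨0, rfl⟩
  have hv : X t ω = s ∧ a t ω = l := by
    simpa [pairProcess, Prod.ext_iff] using h.resolve_left ht.ne'
  have hex : ∃ i, (t : ℕ∞) < visitTime X a s l i ω :=
    ⟨t + 1, by
      rw [← not_le]
      intro h
      have := le_of_visitTime_le h
      omega⟩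
  classical
  have h1 := Nat.find_spec hex
  have h2 : Nat.find hex ≠ 0 := fun h0 => by
    rw [h0] at h1
    simp [visitTime] at h1
  obtain ⟨k, hk⟩ := Nat.exists_eq_succ_of_ne_zero h2
  have h3 : visitTime X a s l k ω ≤ t := not_lt.1 (Nat.find_min hex (by omega))
  refine ⟨k, h3.antisymm (not_lt.1 fun hlt => ?_)⟩
  rw [hk, ← not_le, visitTime_succ_le_iff] at h1
  exact h1 ⟨t, le_rfl, hlt, hv⟩

/-- If the `i`-th visit is at time `t`, then the next return time counts the `u` such that there
is no visit during the `u` steps after `t`. -/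
theorem sum_indicator_noVisit_le_returnTime {i t : ℕ} (h : visitTime X a s l i ω = t) (n : ℕ) :
    ∑ u ∈ Finset.range n, (noVisit (pairProcess X a) (s, l) t u).indicator (1 : Ω → ℝ≥0∞) ω
      ≤ ((returnTime X a s l (i + 1) ω : ℕ∞) : ℝ≥0∞) := by
  classical
  rw [returnTime, Nat.add_sub_cancel, h]
  cases hN : visitTime X a s l (i + 1) ω with
  | top => simp
  | coe N =>
    obtain ⟨k, hkN, hk, hv⟩ := (visitTime_succ_le_iff X a s l i N ω).1 hN.le
    rw [h] at hk
    have hk' : t < k := by exact_mod_cast hk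
    have h1 : ∑ u ∈ Finset.range n,
          (noVisit (pairProcess X a) (s, l) t u).indicator (1 : Ω → ℝ≥0∞) ω
        ≤ ∑ u ∈ Finset.range n, if u < N - t then 1 else 0 := by
      refine Finset.sum_le_sum fun u _ => ?_
      split_ifs with hu
      · exact Set.indicator_apply_le' (fun _ => le_rfl) fun _ => zero_le_one
      · rw [Set.indicator_of_notMem]
        intro hmem
        have hkN' : k ≤ N := hkN
        exact hmem k hk' (by omega) (by simp [pairProcess, hv])
    refine h1.trans ?_
    rw [Finset.sum_boole]
    have h2 : ((Finset.range n).filter fun u => u < N - t).card ≤ N - t := by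
      calc _ ≤ (Finset.range (N - t)).card := Finset.card_le_card fun u hu =>
            Finset.mem_range.2 (Finset.mem_filter.1 hu).2
        _ = N - t := Finset.card_range _
    have h3 : ((N : ℕ∞) - (t : ℕ∞)) = ((N - t : ℕ) : ℕ∞) := by simp
    rw [h3]
    simpa using (Nat.cast_le (α := ℝ≥0∞)).2 h2

end VisitTime

section ReturnTime

variable {Ω χ I : Type*} {mΩ : MeasurableSpace Ω} {μ : Measure Ω}
  {ℱ : Filtration ℕ mΩ} [MeasurableSpace χ] [MeasurableSingletonClass χ] [MeasurableSpace I]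
  [MeasurableSingletonClass I] {X : ℕ → Ω → χ} {a : ℕ → Ω → I} {hX : Adapted ℱ X}
  {ha : Adapted ℱ a} {T : ℕ}

theorem ReturnTimeBound.ae_condLExp_lt (h : ReturnTimeBound μ hX ha T) (s : χ) (l : I) (i : ℕ) :
    ∀ᵐ ω ∂μ, condLExp (isStoppingTime_visitTime hX ha s l i).measurableSpace μ
      (fun ω' => ((returnTime X a s l (i + 1) ω' : ℕ∞) : ℝ≥0∞)) ω < (T : ℝ≥0∞) := by
  filter_upwards [h] with ω hω
  refine lt_of_le_of_lt ?_ hω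
  exact le_iSup_of_le s (le_iSup_of_le l (le_iSup (fun i =>
    condLExp (isStoppingTime_visitTime hX ha s l i).measurableSpace μ
      (fun ω' => ((returnTime X a s l (i + 1) ω' : ℕ∞) : ℝ≥0∞)) ω) i))

variable [IsProbabilityMeasure μ]

/-- Return times are at least `1`, so the strict bound `T` is at least `2`. -/
theorem ReturnTimeBound.two_le (h : ReturnTimeBound μ hX ha T) (s : χ) (l : I) : 2 ≤ T := by
  set m := (isStoppingTime_visitTime hX ha s l 0).measurableSpace with hm
  have hle : m ≤ mΩ := IsStoppingTime.measurableSpace_le _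
  have h1 : (1 : Ω → ℝ≥0∞) ≤ᵐ[μ] fun ω => ((returnTime X a s l (0 + 1) ω : ℕ∞) : ℝ≥0∞) := by
    refine ae_of_all _ fun ω => ?_
    have h2 := sum_indicator_noVisit_le_returnTime (X := X) (a := a) (s := s) (l := l) (ω := ω)
      (i := 0) (t := 0) rfl 1
    refine le_trans ?_ h2
    rw [Finset.sum_range_one, Set.indicator_of_mem]
    intro v hv hv'
    omega
  have h2 := condLExp_mono (mΩ := m) h1
  rw [condLExp_one hle] at h2
  obtain ⟨ω, h3, h4⟩ := (h2.and (h.ae_condLExp_lt s l 0)).exists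
  have h5 : (1 : ℝ≥0∞) < T := lt_of_le_of_lt h3 h4
  exact_mod_cast h5

theorem ReturnTimeBound.hasReturnTail (h : ReturnTimeBound μ hX ha T) (s : χ) (l : I) :
    HasReturnTail μ ℱ (pairProcess X a) (s, l) T := by
  intro t A hA hAt n
  have hZm : ∀ i, Measurable (pairProcess X a i) := fun i =>
    (adapted_pairProcess hX ha i).mono (ℱ.le i) le_rfl
  have hnm : ∀ u, MeasurableSet (noVisit (pairProcess X a) (s, l) t u) := fun u => by
    have : noVisit (pairProcess X a) (s, l) t u
        = ⋂ v ∈ Set.Ioc t (t + u), (pairProcess X a v ⁻¹' {(s, l)})ᶜ := by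
      ext ω
      simp [noVisit]
    rw [this]
    exact MeasurableSet.biInter (Set.to_countable _) fun v _ =>
      (hZm v (measurableSet_singleton _)).compl
  set F : Ω → ℝ≥0∞ := fun ω =>
    ∑ u ∈ Finset.range n, (noVisit (pairProcess X a) (s, l) t u).indicator (1 : Ω → ℝ≥0∞) ω with hF
  -- the event is split according to the index of the visit at time `t`
  set B : ℕ → Set Ω := fun i => A ∩ {ω | visitTime X a s l i ω = (t : ℕ∞)} with hB
  have hvisit : ∀ i, IsStoppingTime ℱ (visitTime X a s l i) := isStoppingTime_visitTime hX ha s l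
  have hBm : ∀ i, MeasurableSet[(hvisit i).measurableSpace] (B i) := fun i =>
    ((hvisit i).measurableSet_inter_eq_iff A t).2 (hA.inter ((hvisit i).measurableSet_eq t))
  have hBm' : ∀ i, MeasurableSet (B i) := fun i => (hvisit i).measurableSpace_le _ (hBm i)
  have hAB : A = ⋃ i, B i := by
    ext ω
    simp only [hB, Set.mem_iUnion, Set.mem_inter_iff, Set.mem_ofPred_eq, exists_and_left]
    refine ⟨fun hω => ⟨hω, exists_visitTime_eq (hAt.imp_right fun h => h ω hω)⟩, fun hω => hω.1⟩
  have hdisj : Pairwise (Function.onFun Disjoint B) := by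
    intro i j hij
    refine Set.disjoint_left.2 fun ω h1 h2 => ?_
    rcases lt_or_gt_of_ne hij with hlt | hlt
    · exact (visitTime_lt_of_lt h1.2 hlt).ne' h2.2
    · exact (visitTime_lt_of_lt h2.2 hlt).ne' h1.2
  have h1 : ∀ i, ∫⁻ ω in B i, F ω ∂μ ≤ T * μ (B i) := fun i => by
    calc ∫⁻ ω in B i, F ω ∂μ
        ≤ ∫⁻ ω in B i, ((returnTime X a s l (i + 1) ω : ℕ∞) : ℝ≥0∞) ∂μ :=
          setLIntegral_mono' (hBm' i) fun ω hω => sum_indicator_noVisit_le_returnTime hω.2 n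
      _ = ∫⁻ ω in B i, condLExp (hvisit i).measurableSpace μ
            (fun ω' => ((returnTime X a s l (i + 1) ω' : ℕ∞) : ℝ≥0∞)) ω ∂μ :=
          (setLIntegral_condLExp (hvisit i).measurableSpace_le μ _ (hBm i)).symm
      _ ≤ ∫⁻ _ in B i, (T : ℝ≥0∞) ∂μ := by
          refine lintegral_mono_ae (ae_restrict_of_ae ?_)
          filter_upwards [h.ae_condLExp_lt s l i] with ω hω using hω.le
      _ = T * μ (B i) := setLIntegral_const _ _
  have h2 : ∫⁻ ω in A, F ω ∂μ ≤ T * μ A := by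
    rw [hAB, lintegral_iUnion hBm' hdisj, measure_iUnion hdisj hBm', ← ENNReal.tsum_mul_left]
    exact ENNReal.tsum_le_tsum h1
  have h3 : ∫⁻ ω in A, F ω ∂μ
      = ∑ u ∈ Finset.range n, μ (A ∩ noVisit (pairProcess X a) (s, l) t u) := by
    rw [hF, lintegral_finsetSum _ fun u _ => measurable_one.indicator (hnm u)]
    refine Finset.sum_congr rfl fun u _ => ?_
    rw [lintegral_indicator_one (hnm u), Measure.restrict_apply (hnm u), Set.inter_comm]
  rw [h3] at h2
  have h4 := ENNReal.toReal_mono (ENNReal.mul_ne_top (ENNReal.natCast_ne_top T)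
    (measure_ne_top μ A)) h2
  rw [ENNReal.toReal_sum fun u _ => measure_ne_top μ _, ENNReal.toReal_mul,
    ENNReal.toReal_natCast] at h4
  exact h4

end ReturnTime

/-! ### Lower tail of the number of visits -/

section VisitTail

/-- Markov's inequality for a real-valued function bounded below by `x` on the event. -/
theorem measureReal_le_of_integral_le {Ω : Type*} {mΩ : MeasurableSpace Ω} {μ : Measure Ω}
    [IsProbabilityMeasure μ] {f : Ω → ℝ} (hf0 : ∀ ω, 0 ≤ f ω) (hf : Integrable f μ) {x y : ℝ}
    (hx : 0 < x) (hy : ∫ ω, f ω ∂μ ≤ x * y) {A : Set Ω} (hA : ∀ ω ∈ A, x ≤ f ω) :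
    μ.real A ≤ y := by
  have h1 := mul_meas_ge_le_integral_of_nonneg (ae_of_all μ hf0) hf x
  have h2 : μ.real A ≤ μ.real {ω | x ≤ f ω} := measureReal_mono hA
  have h3 : x * μ.real A ≤ x * y := (mul_le_mul_of_nonneg_left h2 hx.le).trans (h1.trans hy)
  exact le_of_mul_le_mul_left h3 hx

theorem exp_neg_two_mul_le {c : ℝ} (h0 : 0 ≤ c) (h1 : c ≤ 1 / 2) :
    Real.exp (-(2 * c)) ≤ 1 - c := by
  rw [Real.exp_neg, inv_le_iff_one_le_mul₀ (Real.exp_pos _)]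
  have h2 := Real.add_one_le_exp (2 * c)
  nlinarith

variable {Ω E : Type*} {mΩ : MeasurableSpace Ω} [MeasurableSpace E] [MeasurableSingletonClass E]
  [Fintype E] [DecidableEq E] {μ : Measure Ω} [IsProbabilityMeasure μ] {Z : ℕ → Ω → E}
  {K : Matrix E E ℝ} {w : E} {C : ℝ} {T : ℕ}

/-- `w` is visited at least about `m / T` times up to time `m`, except with exponentially small
probability. -/
theorem measureReal_card_visits_le (hZ : IsMarkovChain μ Z K)
    (h : FrequentVisits K w (fun i => {z | μ.real {ω | Z i ω = z} ≠ 0}) C T) {m : ℕ}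
    (hm : 2 * (T * (4 + 2 * C)) ≤ m) :
    μ.real {ω | (((Finset.Icc 1 m).filter fun i => Z i ω = w).card : ℝ) ≤ m / (128 * T)}
      ≤ Real.exp (-(m / (32 * (T * (4 + 2 * C))))) := by
  have hC := h.nonneg
  have hT : (1 : ℝ) ≤ T := by
    obtain ⟨u, hu, -⟩ := h.gap 1 le_rfl
    exact_mod_cast (Nat.zero_le u).trans_lt hu
  set L := T * (3 + ⌈2 * C⌉₊) with hL
  set c := 1 / (2 * (1 + 2 * C)) with hc
  have hLle : (L : ℝ) ≤ T * (4 + 2 * C) := by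
    rw [hL]
    push_cast
    have := Nat.ceil_lt_add_one (a := 2 * C) (by linarith)
    exact mul_le_mul_of_nonneg_left (by linarith) (by linarith)
  have hL0 : 0 < L := by
    have : 0 < T := by exact_mod_cast hT
    positivity
  have hm1 : 1 ≤ m := by
    have : (1 : ℝ) ≤ m := by nlinarith
    exact_mod_cast this
  set b := (m - 1) / L with hb
  have hbL : b * L + 1 ≤ m := by
    have h1 : b * L ≤ m - 1 := Nat.div_mul_le_self (m - 1) L
    omega
  -- at least half of the time up to `m` is covered by complete blocks
  have hblow : (m : ℝ) / (2 * (T * (4 + 2 * C))) ≤ b := by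
    have h1 : m ≤ (b + 1) * L := by
      have h2 : m - 1 < (b + 1) * L := by
        rw [mul_comm]
        exact Nat.lt_mul_div_succ (m - 1) hL0
      omega
    have h2 : (m : ℝ) ≤ (b + 1) * (T * (4 + 2 * C)) := by
      refine le_trans (by exact_mod_cast h1) (mul_le_mul_of_nonneg_left hLle (by positivity))
    rw [div_le_iff₀ (by positivity)]
    linarith
  have hc0 : 0 ≤ c := by positivity
  have hc1 : c ≤ 1 / 2 := one_div_le_one_div_of_le (by norm_num) (by linarith)
  have hint : ∫ ω, (1 - c) ^ ((Finset.Icc 2 (b * L + 1)).filter fun i => Z i ω = w).card ∂μ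
      ≤ (7 / 8) ^ b := by
    have h1 := integral_comp_eq_sum (μ := μ) (hZ.measurable 1) fun _ => (7 / 8 : ℝ) ^ b
    rw [integral_const, probReal_univ, one_smul] at h1
    rw [hZ.integral_pow_card_visits, integral_comp_eq_sum (hZ.measurable 1), h1]
    refine Finset.sum_le_sum fun z _ => ?_
    by_cases hz : μ.real (Z 1 ⁻¹' {z}) = 0
    · rw [hz, zero_mul, zero_mul]
    · exact mul_le_mul_of_nonneg_left (h.discountedVisits_block_le b le_rfl hz) measureReal_nonneg
  have h78 : ((7 : ℝ) / 8) ^ b ≤ Real.exp (-(b / 16)) * Real.exp (-(b / 16)) := by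
    rw [← Real.exp_add, show -((b : ℝ) / 16) + -(b / 16) = b * (-(1 / 8)) by ring,
      Real.exp_nat_mul]
    have := Real.add_one_le_exp (-(1 / 8 : ℝ))
    exact pow_le_pow_left₀ (by norm_num) (by linarith) b
  refine le_trans (measureReal_le_of_integral_le (fun ω => pow_nonneg (by linarith) _) ?_
    (Real.exp_pos _) (hint.trans h78) ?_) ?_
  · refine DependsOnPast.integrable hZ.measurable (i := b * L + 1) fun ω ω' hω => ?_
    have : (Finset.Icc 2 (b * L + 1)).filter (fun i => Z i ω = w)
        = (Finset.Icc 2 (b * L + 1)).filter fun i => Z i ω' = w :=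
      Finset.filter_congr fun i hi => by rw [hω i (Finset.mem_Icc.1 hi).2]
    simp only [this]
  · intro ω hω
    set N := ((Finset.Icc 2 (b * L + 1)).filter fun i => Z i ω = w).card with hN
    have h1 : (N : ℝ) ≤ m / (128 * T) := by
      refine le_trans ?_ hω
      exact_mod_cast Finset.card_le_card (Finset.filter_subset_filter _
        (Finset.Icc_subset_Icc (by norm_num) hbL))
    have h2 : 2 * c * N ≤ b / 16 := by
      have h3 : 2 * c * N ≤ 2 * c * (m / (128 * T)) :=
        mul_le_mul_of_nonneg_left h1 (by linarith)
      have h4 : 2 * c * (m / (128 * T)) ≤ m / (2 * (T * (4 + 2 * C))) / 16 := by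
        rw [hc, show 2 * (1 / (2 * (1 + 2 * C))) * ((m : ℝ) / (128 * T))
          = m / ((1 + 2 * C) * (128 * T)) by field_simp, div_div]
        refine div_le_div_of_nonneg_left (Nat.cast_nonneg m) (by positivity) ?_
        nlinarith
      linarith
    calc Real.exp (-(b / 16)) ≤ Real.exp (N * (-(2 * c))) := Real.exp_le_exp.2 (by linarith)
      _ = Real.exp (-(2 * c)) ^ N := Real.exp_nat_mul _ _
      _ ≤ (1 - c) ^ N := pow_le_pow_left₀ (Real.exp_pos _).le (exp_neg_two_mul_le hc0 hc1) N
  · refine Real.exp_le_exp.2 (neg_le_neg ?_)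
    have h1 : (m : ℝ) / (32 * (T * (4 + 2 * C))) = m / (2 * (T * (4 + 2 * C))) / 16 := by
      rw [div_div]
      ring
    rw [h1]
    linarith

end VisitTail

/-! ### Deviations of the empirical transition matrices -/

section Deviation

/-- A form of Hoeffding's lemma for finitely many values whose differences are at most `D`. -/
theorem sum_mul_exp_le {χ : Type*} [Fintype χ] {q v : χ → ℝ} (hq : ∀ t, 0 ≤ q t)
    (hq1 : ∑ t, q t = 1) {D : ℝ} (hD : 0 < D) (hv : ∀ t u, v t - v u ≤ D) (r : ℝ) :
    ∑ t, q t * Real.exp (r * (v t - ∑ u, q u * v u)) ≤ Real.exp (r ^ 2 * D ^ 2 / 2) := by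
  have h1 : ∀ t, |(v t - ∑ u, q u * v u) / D| ≤ 1 := fun t => by
    rw [abs_div, abs_of_pos hD, div_le_one hD]
    have h2 : v t - ∑ u, q u * v u = ∑ u, q u * (v t - v u) := by
      simp only [mul_sub, Finset.sum_sub_distrib, ← Finset.sum_mul, hq1, one_mul]
    rw [h2]
    exact abs_sum_mul_le hq hq1.le hD.le fun u => abs_le.2 ⟨by linarith [hv u t], hv t u⟩
  calc ∑ t, q t * Real.exp (r * (v t - ∑ u, q u * v u))
      ≤ ∑ t, q t * (Real.cosh (r * D)
          + (v t - ∑ u, q u * v u) / D * Real.sinh (r * D)) := by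
        refine Finset.sum_le_sum fun t _ => mul_le_mul_of_nonneg_left ?_ (hq t)
        have h3 := Real.exp_mul_le_cosh_add_mul_sinh (h1 t) (r * D)
        rwa [show (v t - ∑ u, q u * v u) / D * (r * D) = r * (v t - ∑ u, q u * v u) by
          field_simp] at h3
    _ = Real.cosh (r * D) := by
        have h4 : ∀ t, q t * (Real.cosh (r * D)
              + (v t - ∑ u, q u * v u) / D * Real.sinh (r * D))
            = q t * Real.cosh (r * D)
              + (q t * v t - q t * ∑ u, q u * v u) * (Real.sinh (r * D) / D) := fun t => by
          ring
        simp only [h4, Finset.sum_add_distrib, ← Finset.sum_mul, Finset.sum_sub_distrib, hq1]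
        ring
    _ ≤ Real.exp ((r * D) ^ 2 / 2) := Real.cosh_le_exp_half_sq _
    _ = Real.exp (r ^ 2 * D ^ 2 / 2) := by rw [mul_pow]

variable {Ω χ I : Type*} [Fintype χ] [DecidableEq χ] [DecidableEq I]

/-- The sum of the centred values `v (X (i + 1)) - (M l v) s` over the times `i = 1, …, n` at which
`(X i, a i) = (s, l)`. -/
noncomputable def centredSum (X : ℕ → Ω → χ) (a : ℕ → Ω → I) (M : I → Matrix χ χ ℝ) (v : χ → ℝ)
    (s : χ) (l : I) (n : ℕ) (ω : Ω) : ℝ :=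
  ∑ i ∈ Finset.Icc 1 n,
    if pairProcess X a i ω = (s, l) then v (X (i + 1) ω) - (M l *ᵥ v) s else 0

variable {X : ℕ → Ω → χ} {a : ℕ → Ω → I} {M : I → Matrix χ χ ℝ} {v : χ → ℝ} {s : χ} {l : I}

theorem centredSum_neg (n : ℕ) (ω : Ω) :
    centredSum X a M (-v) s l n ω = -centredSum X a M v s l n ω := by
  rw [centredSum, centredSum, ← Finset.sum_neg_distrib]
  refine Finset.sum_congr rfl fun i _ => ?_
  rw [Matrix.mulVec_neg]
  split_ifs
  · rw [Pi.neg_apply, Pi.neg_apply]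
    ring
  · rw [neg_zero]

/-- The centred sum is the number of visits times the error of the empirical row, tested
against `v`. -/
theorem centredSum_eq (n : ℕ) (ω : Ω) (h : visitCount X a n s l ω ≠ 0) :
    centredSum X a M v s l n ω
      = visitCount X a n s l ω * ((empiricalMatrix X a n ω l *ᵥ v) s - (M l *ᵥ v) s) := by
  have h0 : (visitCount X a n s l ω : ℝ) ≠ 0 := by exact_mod_cast h
  have h1 : ((visitCount X a n s l ω : ℝ)) * (empiricalMatrix X a n ω l *ᵥ v) s
      = ∑ t, (transitionCount X a n s t l ω : ℝ) * v t := by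
    simp only [Matrix.mulVec, dotProduct, empiricalMatrix, Matrix.of_apply, Finset.mul_sum]
    refine Finset.sum_congr rfl fun t _ => ?_
    field_simp
  rw [mul_sub, h1]
  simp only [transitionCount, visitCount, centredSum, Finset.card_filter, Nat.cast_sum,
    Finset.sum_mul]
  rw [Finset.sum_comm, ← Finset.sum_sub_distrib]
  refine Finset.sum_congr rfl fun i _ => ?_
  by_cases h2 : X i ω = s ∧ a i ω = l
  · obtain ⟨hs, hl⟩ := h2
    simp [pairProcess, hs, hl]
  · rw [if_neg (by simpa [pairProcess] using h2), if_neg h2]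
    have h3 : ∀ t, ¬(X i ω = s ∧ X (i + 1) ω = t ∧ a i ω = l) := fun t ht => h2 ⟨ht.1, ht.2.2⟩
    simp [h3]

theorem dependsOnPast_centredSum (r κ : ℝ) (n : ℕ) :
    DependsOnPast (pairProcess X a) (n + 1) fun ω =>
      Real.exp (r * centredSum X a M v s l n ω - κ * visitCount X a n s l ω) := by
  intro ω ω' hω
  have h1 : centredSum X a M v s l n ω = centredSum X a M v s l n ω' := by
    refine Finset.sum_congr rfl fun i hi => ?_
    have hi' := (Finset.mem_Icc.1 hi).2
    have h2 : X (i + 1) ω = X (i + 1) ω' := congrArg Prod.fst (hω (i + 1) (by omega))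
    rw [hω i (by omega), h2]
  have h2 : visitCount X a n s l ω = visitCount X a n s l ω' := by
    refine congrArg Finset.card (Finset.filter_congr fun i hi => ?_)
    have hi' := hω i (by have := (Finset.mem_Icc.1 hi).2; omega)
    rw [show X i ω = X i ω' from congrArg Prod.fst hi',
      show a i ω = a i ω' from congrArg Prod.snd hi']
  simp only [h1, h2]

variable {mΩ : MeasurableSpace Ω} {μ : Measure Ω} [IsProbabilityMeasure μ] [Fintype I]
  [MeasurableSpace χ] [MeasurableSpace I] [MeasurableSingletonClass χ] [MeasurableSingletonClass I]
  {P : χ → I → ℝ}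

/-- The exponential supermartingale of the centred sums. -/
theorem integral_exp_centredSum_le_one
    (hZ : IsMarkovChain μ (pairProcess X a) (jointMatrix M P)) (hP : ∀ s, P s ∈ stdSimplex ℝ I)
    (hM : M l ∈ Matrix.rowStochastic ℝ χ) {D : ℝ} (hD : 0 < D) (hv : ∀ t u, v t - v u ≤ D)
    (r : ℝ) (n : ℕ) :
    ∫ ω, Real.exp (r * centredSum X a M v s l n ω - r ^ 2 * D ^ 2 / 2 * visitCount X a n s l ω) ∂μ
      ≤ 1 := by
  set κ := r ^ 2 * D ^ 2 / 2 with hκ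
  induction n with
  | zero => simp [centredSum, visitCount]
  | succ n ih =>
    refine le_trans ?_ ih
    set U := fun ω => Real.exp (r * centredSum X a M v s l n ω - κ * visitCount X a n s l ω) with hU
    set ψ : χ → ℝ := fun t => Real.exp (r * (v t - (M l *ᵥ v) s) - κ) with hψ
    have hUd : DependsOnPast (pairProcess X a) (n + 1) U := dependsOnPast_centredSum r κ n
    set Y := fun ω => if pairProcess X a (n + 1) ω = (s, l) then U ω else 0 with hY
    have hYd : DependsOnPast (pairProcess X a) (n + 1) Y := fun ω ω' hω => by
      simp only [hY, hω (n + 1) le_rfl, hUd ω ω' hω]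
    have hstep : ∀ ω, Real.exp (r * centredSum X a M v s l (n + 1) ω
          - κ * visitCount X a (n + 1) s l ω)
        = (U ω - Y ω) + Y ω * ψ (pairProcess X a (n + 1 + 1) ω).1 := fun ω => by
      have hIcc : Finset.Icc 1 (n + 1) = insert (n + 1) (Finset.Icc 1 n) :=
        (Finset.insert_Icc_right_eq_Icc_add_one (by omega)).symm
      have hnot : n + 1 ∉ Finset.Icc 1 n := by simp
      have hv1 : visitCount X a (n + 1) s l ω
          = visitCount X a n s l ω + if pairProcess X a (n + 1) ω = (s, l) then 1 else 0 := by
        rw [visitCount, hIcc, Finset.filter_insert]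
        by_cases h : X (n + 1) ω = s ∧ a (n + 1) ω = l
        · rw [if_pos h, if_pos (by simpa [pairProcess] using h),
            Finset.card_insert_of_notMem (by simp)]
          rfl
        · rw [if_neg h, if_neg (by simpa [pairProcess] using h)]
          rfl
      have hc1 : centredSum X a M v s l (n + 1) ω = (if pairProcess X a (n + 1) ω = (s, l) then
          v (X (n + 1 + 1) ω) - (M l *ᵥ v) s else 0) + centredSum X a M v s l n ω := by
        rw [centredSum, hIcc, Finset.sum_insert hnot]
        rfl
      rw [hv1, hc1]
      by_cases h : pairProcess X a (n + 1) ω = (s, l)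
      · simp only [hY, hU, hψ, if_pos h, sub_self, zero_add]
        rw [← Real.exp_add]
        congr 1
        simp only [pairProcess]
        push_cast
        ring
      · simp only [hY, hU, if_neg h, zero_mul, zero_add, add_zero, sub_zero]
    have hψ1 : (M l *ᵥ ψ) s ≤ 1 := by
      have h1 := sum_mul_exp_le (q := M l s) (v := v)
        (fun t => Matrix.nonneg_of_mem_rowStochastic hM)
        (Matrix.sum_row_of_mem_rowStochastic hM s) hD hv r
      have h2 : (M l *ᵥ ψ) s
          = (∑ t, M l s t * Real.exp (r * (v t - ∑ u, M l s u * v u))) * Real.exp (-κ) := by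
        rw [Finset.sum_mul]
        refine Finset.sum_congr rfl fun t _ => ?_
        rw [mul_assoc, ← Real.exp_add, ← sub_eq_add_neg]
        rfl
      rw [h2]
      refine (mul_le_mul_of_nonneg_right h1 (Real.exp_pos _).le).trans ?_
      rw [← Real.exp_add, hκ, add_neg_cancel, Real.exp_zero]
    have hUi : Integrable U μ := hUd.integrable hZ.measurable
    have hYi : Integrable Y μ := hYd.integrable hZ.measurable
    have hYψd : DependsOnPast (pairProcess X a) (n + 1 + 1)
        fun ω => Y ω * ψ (pairProcess X a (n + 1 + 1) ω).1 := fun ω ω' hω => by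
      simp only [hYd ω ω' fun j hj => hω j (by omega), hω (n + 1 + 1) le_rfl]
    have hYψ2 : DependsOnPast (pairProcess X a) (n + 1)
        fun ω => Y ω * (jointMatrix M P *ᵥ fun y => ψ y.1) (pairProcess X a (n + 1) ω) :=
      fun ω ω' hω => by simp only [hYd ω ω' hω, hω (n + 1) le_rfl]
    simp only [hstep]
    rw [integral_add (f := fun ω => U ω - Y ω) (hUi.sub hYi) (hYψd.integrable hZ.measurable),
      integral_sub hUi hYi,
      hZ.integral_mul_comp_succ hYd fun y => ψ y.1]
    have h3 : ∫ ω, Y ω * (jointMatrix M P *ᵥ fun y => ψ y.1) (pairProcess X a (n + 1) ω) ∂μ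
        ≤ ∫ ω, Y ω ∂μ := by
      refine integral_mono (hYψ2.integrable hZ.measurable) hYi fun ω => ?_
      by_cases h : pairProcess X a (n + 1) ω = (s, l)
      · rw [jointMatrix_mulVec_comp_fst hP, h]
        refine mul_le_of_le_one_right ?_ hψ1
        simp only [hY, if_pos h, hU]
        exact (Real.exp_pos _).le
      · simp [hY, if_neg h]
    linarith

/-- One-sided deviation bound. The number of visits is random; the exponential supermartingale with
a fixed parameter handles all values `≥ n₀` at once. -/
theorem measureReal_centredSum_ge_le
    (hZ : IsMarkovChain μ (pairProcess X a) (jointMatrix M P)) (hP : ∀ s, P s ∈ stdSimplex ℝ I)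
    (hM : M l ∈ Matrix.rowStochastic ℝ χ) {D : ℝ} (hD : 0 < D) (hv : ∀ t u, v t - v u ≤ D)
    {η : ℝ} (hη : 0 ≤ η) (n₀ : ℝ) (n : ℕ) :
    μ.real {ω | n₀ ≤ visitCount X a n s l ω ∧
        η * visitCount X a n s l ω ≤ centredSum X a M v s l n ω}
      ≤ Real.exp (-(n₀ * η ^ 2 / (2 * D ^ 2))) := by
  -- the parameter `r = η / D ^ 2` maximizes `r η - r ^ 2 D ^ 2 / 2`
  refine measureReal_le_of_integral_le
    (f := fun ω => Real.exp (η / D ^ 2 * centredSum X a M v s l n ω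
      - (η / D ^ 2) ^ 2 * D ^ 2 / 2 * visitCount X a n s l ω))
    (x := Real.exp (n₀ * η ^ 2 / (2 * D ^ 2)))
    (fun ω => (Real.exp_pos _).le)
    ((dependsOnPast_centredSum (η / D ^ 2) ((η / D ^ 2) ^ 2 * D ^ 2 / 2) n).integrable
      hZ.measurable) (Real.exp_pos _) ?_ ?_
  · rw [← Real.exp_add, add_neg_cancel, Real.exp_zero]
    exact integral_exp_centredSum_le_one hZ hP hM hD hv _ n
  · rintro ω ⟨h1, h2⟩
    refine Real.exp_le_exp.2 ?_
    set N : ℝ := (visitCount X a n s l ω : ℝ)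
    have h3 : η / D ^ 2 * (η * N) ≤ η / D ^ 2 * centredSum X a M v s l n ω :=
      mul_le_mul_of_nonneg_left h2 (by positivity)
    have h4 : η ^ 2 / (2 * D ^ 2) * n₀ ≤ η ^ 2 / (2 * D ^ 2) * N :=
      mul_le_mul_of_nonneg_left h1 (by positivity)
    have h5 : η / D ^ 2 * (η * N) - (η / D ^ 2) ^ 2 * D ^ 2 / 2 * N = η ^ 2 / (2 * D ^ 2) * N := by
      field_simp
      ring
    have h6 : n₀ * η ^ 2 / (2 * D ^ 2) = η ^ 2 / (2 * D ^ 2) * n₀ := by ring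
    linarith

end Deviation

/-! ### Estimation of the value function -/

section Estimation

theorem empiricalMatrix_nonneg {Ω χ I : Type*} [DecidableEq χ] [DecidableEq I] (X : ℕ → Ω → χ)
    (a : ℕ → Ω → I) (m : ℕ) (ω : Ω) (l : I) (s t : χ) : 0 ≤ empiricalMatrix X a m ω l s t :=
  div_nonneg (Nat.cast_nonneg _) (Nat.cast_nonneg _)

variable {Ω χ I : Type*} [DecidableEq χ] [DecidableEq I] {X : ℕ → Ω → χ} {a : ℕ → Ω → I} {m : ℕ}
  {ω : Ω} {s : χ} {l : I}

theorem empiricalMatrix_eq_zero (h : visitCount X a m s l ω = 0) (t : χ) :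
    empiricalMatrix X a m ω l s t = 0 := by
  rw [empiricalMatrix, Matrix.of_apply, h, Nat.cast_zero, div_zero]

variable [Fintype χ] {M : I → Matrix χ χ ℝ}

theorem empiricalMatrix_sum_row (h : visitCount X a m s l ω ≠ 0) :
    ∑ t, empiricalMatrix X a m ω l s t = 1 := by
  have h0 : (visitCount X a m s l ω : ℝ) ≠ 0 := by exact_mod_cast h
  simp only [empiricalMatrix, Matrix.of_apply]
  rw [← Finset.sum_div, div_eq_one_iff_eq h0]
  have h1 : visitCount X a m s l ω = ∑ t, transitionCount X a m s t l ω := by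
    rw [visitCount, Finset.card_eq_sum_card_fiberwise (f := fun i => X (i + 1) ω)
      (t := Finset.univ) (fun _ _ => Finset.mem_coe.2 (Finset.mem_univ _))]
    refine Finset.sum_congr rfl fun t _ => ?_
    rw [transitionCount, Finset.filter_filter]
    congr 1
    refine Finset.filter_congr fun i _ => ?_
    tauto
  rw [h1, Nat.cast_sum]

theorem empiricalMatrix_sum_row_le_one (X : ℕ → Ω → χ) (a : ℕ → Ω → I) (m : ℕ) (ω : Ω) (l : I)
    (s : χ) : ∑ t, empiricalMatrix X a m ω l s t ≤ 1 := by
  by_cases h : visitCount X a m s l ω = 0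
  · simp [empiricalMatrix_eq_zero h]
  · exact (empiricalMatrix_sum_row h).le

/-- Crude error bound for one row: both a missing row and the difference of two probability vectors
contribute at most `D`, if `v` is bounded by `D` and has oscillation at most `D`. -/
theorem abs_empiricalMatrix_mulVec_sub_le (hM : M l ∈ Matrix.rowStochastic ℝ χ) {v : χ → ℝ} {D : ℝ}
    (hv : ∀ t, |v t| ≤ D) (hosc : ∀ t u, v t - v u ≤ D) :
    |(empiricalMatrix X a m ω l *ᵥ v) s - (M l *ᵥ v) s| ≤ D := by
  have hD : 0 ≤ D := (abs_nonneg _).trans (hv s)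
  have hM0 : ∀ t, 0 ≤ M l s t := fun t => Matrix.nonneg_of_mem_rowStochastic hM
  have hM1 := Matrix.sum_row_of_mem_rowStochastic hM s
  by_cases h : visitCount X a m s l ω = 0
  · have h1 : (empiricalMatrix X a m ω l *ᵥ v) s = 0 :=
      Finset.sum_eq_zero fun t _ => mul_eq_zero_of_left (empiricalMatrix_eq_zero h t) _
    rw [h1, zero_sub, abs_neg]
    exact abs_sum_mul_le hM0 hM1.le hD hv
  · have h1 : (empiricalMatrix X a m ω l *ᵥ v) s - (M l *ᵥ v) s
        = ∑ t, empiricalMatrix X a m ω l s t * (v t - (M l *ᵥ v) s) := by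
      simp only [mul_sub, Finset.sum_sub_distrib, ← Finset.sum_mul, empiricalMatrix_sum_row h,
        one_mul]
      rfl
    have h2 : ∀ t, v t - (M l *ᵥ v) s = ∑ u, M l s u * (v t - v u) := fun t => by
      simp only [mul_sub, Finset.sum_sub_distrib, ← Finset.sum_mul, hM1, one_mul]
      rfl
    rw [h1]
    refine abs_sum_mul_le (empiricalMatrix_nonneg X a m ω l s)
      (empiricalMatrix_sum_row_le_one X a m ω l s) hD fun t => ?_
    rw [h2]
    exact abs_sum_mul_le hM0 hM1.le hD fun u => abs_le.2 ⟨by linarith [hosc u t], hosc t u⟩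

variable [Fintype I] {π : χ → I → ℝ} {α : ℝ}

/-- If every row is estimated with error at most `η`, tested against the value function, then the
value function is estimated with Euclidean error at most `α η √d / (1 - α)`. -/
theorem norm_discountedValue_empirical_sub_le (hM : ∀ l, M l ∈ Matrix.rowStochastic ℝ χ)
    (hπ : ∀ s, π s ∈ stdSimplex ℝ I) (hα : α ∈ Set.Ioo (0 : ℝ) 1) (g : χ → ℝ) {η : ℝ} (hη0 : 0 ≤ η)
    (h : ∀ s l, |(empiricalMatrix X a m ω l *ᵥ discountedValue α (policyMatrix π M) g) s
      - (M l *ᵥ discountedValue α (policyMatrix π M) g) s| ≤ η) :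
    ‖WithLp.toLp 2 (discountedValue α (policyMatrix π (empiricalMatrix X a m ω)) g
        - discountedValue α (policyMatrix π M) g)‖
      ≤ √(Fintype.card χ) * (α * η / (1 - α)) := by
  have hQ := policyMatrix_mem_rowStochastic hπ hM
  exact norm_discountedValue_sub_le hα (fun s t => Matrix.nonneg_of_mem_rowStochastic hQ)
    (fun s => (Matrix.sum_row_of_mem_rowStochastic hQ s).le)
    (policyMatrix_nonneg hπ (empiricalMatrix_nonneg X a m ω))
    (policyMatrix_sum_row_le_one hπ (empiricalMatrix_sum_row_le_one X a m ω)) g hη0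
    fun s => abs_policyMatrix_sub_mulVec_le hπ hη0 s (h s)

/-- The error is never more than `√(T_α / T)`. -/
theorem norm_discountedValue_empirical_sub_sq_le (hM : ∀ l, M l ∈ Matrix.rowStochastic ℝ χ)
    (hπ : ∀ s, π s ∈ stdSimplex ℝ I) (hα : α ∈ Set.Ioo (0 : ℝ) 1) (g : χ → ℝ) {T : ℕ} (hT : 0 < T) :
    ‖WithLp.toLp 2 (discountedValue α (policyMatrix π (empiricalMatrix X a m ω)) g
        - discountedValue α (policyMatrix π M) g)‖ ^ 2 ≤ effectiveT α g T / T := by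
  have h1α : 0 < 1 - α := sub_pos.2 hα.2
  have hQ := policyMatrix_mem_rowStochastic hπ hM
  have hb : ∀ s l, |(empiricalMatrix X a m ω l *ᵥ discountedValue α (policyMatrix π M) g) s
      - (M l *ᵥ discountedValue α (policyMatrix π M) g) s| ≤ (∑ t, |g t|) / (1 - α) := fun s l =>
    abs_empiricalMatrix_mulVec_sub_le (hM l)
      (abs_discountedValue_le hα (fun s t => Matrix.nonneg_of_mem_rowStochastic hQ)
        (fun s => (Matrix.sum_row_of_mem_rowStochastic hQ s).le) g)
      (discountedValue_sub_le hα hQ g)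
  have h1 := norm_discountedValue_empirical_sub_le hM hπ hα g
    (div_nonneg (Finset.sum_nonneg fun _ _ => abs_nonneg _) h1α.le) hb
  refine (pow_le_pow_left₀ (norm_nonneg _) h1 2).trans (le_of_eq ?_)
  have hT' : (T : ℝ) ≠ 0 := by exact_mod_cast hT.ne'
  rw [mul_pow, Real.sq_sqrt (Nat.cast_nonneg _), effectiveT]
  field_simp

variable {mΩ : MeasurableSpace Ω} {μ : Measure Ω} [IsProbabilityMeasure μ]
  [MeasurableSpace χ] [MeasurableSpace I] [MeasurableSingletonClass χ] [MeasurableSingletonClass I]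
  {P : χ → I → ℝ} {T : ℕ} {C : ℝ}

/-- Union bound over the state-control pairs: each pair has to be visited often, and its centred
sum has to be small in both directions. -/
theorem measureReal_norm_discountedValue_sub_gt_le
    (hZ : IsMarkovChain μ (pairProcess X a) (jointMatrix M P)) (hP : ∀ s, P s ∈ stdSimplex ℝ I)
    (hM : ∀ l, M l ∈ Matrix.rowStochastic ℝ χ)
    (hF : ∀ w, FrequentVisits (jointMatrix M P) w
      (fun i => {z | μ.real {ω | pairProcess X a i ω = z} ≠ 0}) C T)
    (hT : 0 < T) (hπ : ∀ s, π s ∈ stdSimplex ℝ I) (hα : α ∈ Set.Ioo (0 : ℝ) 1) (g : χ → ℝ) {ε : ℝ}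
    (hε : 0 < ε) (hx : 0 < effectiveT α g T) (hm0 : 0 < m) (hm : 2 * (T * (4 + 2 * C)) ≤ m) :
    μ.real {ω | ε < ‖WithLp.toLp 2
        (discountedValue α (policyMatrix π (empiricalMatrix X a m ω)) g
          - discountedValue α (policyMatrix π M) g)‖}
      ≤ Fintype.card χ * Fintype.card I * (Real.exp (-(m / (32 * (T * (4 + 2 * C)))))
        + 2 * Real.exp (-(m / (256 * (effectiveT α g T / ε ^ 2))))) := by
  have hα0 := hα.1
  have h1α : 0 < 1 - α := sub_pos.2 hα.2
  have hT' : (0 : ℝ) < T := by exact_mod_cast hT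
  have hm' : (0 : ℝ) < m := by exact_mod_cast hm0
  -- positivity of `T_α` excludes the degenerate cases `g = 0` and `d = 0`
  have hg : 0 < ∑ t, |g t| := by
    refine lt_of_le_of_ne (Finset.sum_nonneg fun _ _ => abs_nonneg _) fun h0 => ?_
    rw [effectiveT, ← h0] at hx
    simp at hx
  have hd : (0 : ℝ) < Fintype.card χ := by
    refine lt_of_le_of_ne (Nat.cast_nonneg _) fun h0 => ?_
    rw [effectiveT, ← h0] at hx
    simp at hx
  set Γ := (∑ t, |g t|) / (1 - α) with hΓ
  have hΓ0 : 0 < Γ := div_pos hg h1α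
  set V := discountedValue α (policyMatrix π M) g with hV
  have hosc : ∀ t u, V t - V u ≤ Γ :=
    discountedValue_sub_le hα (policyMatrix_mem_rowStochastic hπ hM) g
  -- the row error that leads to a Euclidean error `ε`
  set η := ε * (1 - α) / (α * √(Fintype.card χ)) with hη
  have hsqrt : 0 < √(Fintype.card χ : ℝ) := Real.sqrt_pos.2 hd
  have hη0 : 0 < η := by positivity
  set n₀ := (m : ℝ) / (128 * T) with hn₀
  have hn₀0 : 0 < n₀ := by positivity
  have hexp : n₀ * η ^ 2 / (2 * Γ ^ 2) = m / (256 * (effectiveT α g T / ε ^ 2)) := by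
    rw [hn₀, hη, hΓ, effectiveT, div_pow (ε * (1 - α)), mul_pow α, Real.sq_sqrt hd.le]
    field_simp
    ring
  set B₁ : χ × I → Set Ω := fun p => {ω | (visitCount X a m p.1 p.2 ω : ℝ) ≤ n₀} with hB₁
  set B₂ : χ × I → Set Ω := fun p => {ω | n₀ ≤ visitCount X a m p.1 p.2 ω ∧
    η * visitCount X a m p.1 p.2 ω ≤ centredSum X a M V p.1 p.2 m ω} with hB₂
  set B₃ : χ × I → Set Ω := fun p => {ω | n₀ ≤ visitCount X a m p.1 p.2 ω ∧
    η * visitCount X a m p.1 p.2 ω ≤ centredSum X a M (-V) p.1 p.2 m ω} with hB₃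
  have hμ₁ : ∀ p, μ.real (B₁ p) ≤ Real.exp (-(m / (32 * (T * (4 + 2 * C))))) := fun p => by
    have h1 := measureReal_card_visits_le hZ (hF p) hm
    refine le_trans (le_of_eq ?_) h1
    congr 1
    ext ω
    simp only [hB₁, visitCount, pairProcess, Set.mem_ofPred_eq, Prod.ext_iff]
    exact Iff.rfl
  have hμ₂ : ∀ p, μ.real (B₂ p) ≤ Real.exp (-(m / (256 * (effectiveT α g T / ε ^ 2)))) := fun p =>
    hexp ▸ measureReal_centredSum_ge_le hZ hP (hM p.2) hΓ0 hosc hη0.le n₀ m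
  have hμ₃ : ∀ p, μ.real (B₃ p) ≤ Real.exp (-(m / (256 * (effectiveT α g T / ε ^ 2)))) := fun p =>
    hexp ▸ measureReal_centredSum_ge_le hZ hP (hM p.2) hΓ0
      (fun t u => by simpa [sub_eq_add_neg, add_comm] using hosc u t) hη0.le n₀ m
  have hsub : {ω | ε < ‖WithLp.toLp 2
        (discountedValue α (policyMatrix π (empiricalMatrix X a m ω)) g - V)‖}
      ⊆ ⋃ p ∈ (Finset.univ : Finset (χ × I)), (B₁ p ∪ (B₂ p ∪ B₃ p)) := by
    intro ω hω
    by_contra hcon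
    simp only [Finset.mem_univ, Set.iUnion_true, Set.mem_iUnion, Set.mem_union, not_exists,
      not_or] at hcon
    refine (not_lt.2 ?_ : ¬ ε < _) hω
    have hrow : ∀ s l, |(empiricalMatrix X a m ω l *ᵥ V) s - (M l *ᵥ V) s| ≤ η := fun s l => by
      obtain ⟨h1, h2, h3⟩ := hcon (s, l)
      simp only [hB₁, hB₂, hB₃, Set.mem_ofPred_eq, not_and, not_le] at h1 h2 h3
      have hN : (0 : ℝ) < visitCount X a m s l ω := hn₀0.trans h1
      have hN' : visitCount X a m s l ω ≠ 0 := by exact_mod_cast hN.ne'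
      have h4 := h2 h1.le
      have h5 := h3 h1.le
      rw [centredSum_neg] at h5
      rw [centredSum_eq m ω hN'] at h4 h5
      refine abs_le.2 ⟨?_, ?_⟩ <;> nlinarith
    refine (norm_discountedValue_empirical_sub_le hM hπ hα g hη0.le hrow).trans (le_of_eq ?_)
    rw [hη]
    field_simp
  calc _ ≤ μ.real (⋃ p ∈ (Finset.univ : Finset (χ × I)), (B₁ p ∪ (B₂ p ∪ B₃ p))) :=
        measureReal_mono hsub (measure_ne_top μ _)
    _ ≤ ∑ p : χ × I, μ.real (B₁ p ∪ (B₂ p ∪ B₃ p)) := measureReal_biUnion_finset_le _ _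
    _ ≤ ∑ _p : χ × I, (Real.exp (-(m / (32 * (T * (4 + 2 * C)))))
        + 2 * Real.exp (-(m / (256 * (effectiveT α g T / ε ^ 2))))) := by
        refine Finset.sum_le_sum fun p _ => ?_
        have h1 := measureReal_union_le (μ := μ) (B₁ p) (B₂ p ∪ B₃ p)
        have h2 := measureReal_union_le (μ := μ) (B₂ p) (B₃ p)
        linarith [hμ₁ p, hμ₂ p, hμ₃ p]
    _ = _ := by
        rw [Finset.sum_const, Finset.card_univ, Fintype.card_prod, nsmul_eq_mul, Nat.cast_mul]

/-- If `n ≥ 3 log (2 y / δ)` with `y ≥ 1`, then `exp (-n)` is at most `δ / (8 y)`. -/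
theorem mul_exp_neg_le {y δ n : ℝ} (hy : 1 ≤ y) (hδ : δ ∈ Set.Ioo (0 : ℝ) 1)
    (hn : 3 * Real.log (2 * y / δ) ≤ n) : y * Real.exp (-n) ≤ δ / 8 := by
  have hδ0 := hδ.1
  have hpos : 0 < 2 * y / δ := by positivity
  have h1 : Real.exp (-n) ≤ (δ / (2 * y)) ^ 3 := by
    have h3 : (δ / (2 * y)) ^ 3 = Real.exp (-(3 * Real.log (2 * y / δ))) := by
      rw [show 3 * Real.log (2 * y / δ) = (3 : ℕ) * Real.log (2 * y / δ) by norm_num,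
        Real.exp_neg, Real.exp_nat_mul, Real.exp_log hpos, ← inv_pow, inv_div]
    rw [h3]
    exact Real.exp_le_exp.2 (neg_le_neg hn)
  refine (mul_le_mul_of_nonneg_left h1 (by linarith)).trans ?_
  have h2 : y * (δ / (2 * y)) ^ 3 = δ / 8 * (δ / y) ^ 2 := by
    field_simp
    ring
  rw [h2]
  refine mul_le_of_le_one_right (by linarith) (pow_le_one₀ (by positivity) ?_)
  rw [div_le_one (by linarith)]
  linarith [hδ.2]

end Estimation

/-! ### Sample size -/

section SampleSize

variable {Ω χ I : Type*} {mΩ : MeasurableSpace Ω} {μ : Measure Ω} [IsProbabilityMeasure μ]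
  {ℱ : Filtration ℕ mΩ} [Fintype χ] [DecidableEq χ] [MeasurableSpace χ] [MeasurableSingletonClass χ]
  [Fintype I] [DecidableEq I] [MeasurableSpace I] [MeasurableSingletonClass I] {X : ℕ → Ω → χ}
  {a : ℕ → Ω → I} {M : I → Matrix χ χ ℝ} {P : χ → I → ℝ} {T : ℕ} {C : ℝ}

/-- The chain of state-control pairs visits every pair frequently. -/
theorem frequentVisits_jointMatrix {hX : Adapted ℱ X} {ha : Adapted ℱ a}
    (hZ : IsMarkovChain μ (pairProcess X a) (jointMatrix M P))
    (hM : ∀ l, M l ∈ Matrix.rowStochastic ℝ χ) (hP : ∀ s, P s ∈ stdSimplex ℝ I)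
    (hret : ReturnTimeBound μ hX ha T) (hmix : StateMixing μ X a C) (w : χ × I) :
    FrequentVisits (jointMatrix M P) w
      (fun i => {z | μ.real {ω | pairProcess X a i ω = z} ≠ 0}) C T where
  stochastic := jointMatrix_mem_rowStochastic hM hP
  nonneg := hmix.1
  step _ _ _ _ hz hy := hZ.possible_succ hz hy
  mixing _ hi _ hz _ hy n := expectedVisits_le_add hZ hP hmix hi w hz hy n
  renewal _ _ hw n :=
    (hret.hasReturnTail w.1 w.2).le_mul_one_add_expectedVisits (adapted_pairProcess hX ha) hZ hw n
  gap _ hi := (hret.hasReturnTail w.1 w.2).exists_possible_of_one_le (adapted_pairProcess hX ha) hi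

/-- The sample size bound in the form in which it is used: the time horizon is long compared with
`T (1 + C)` for the visit counts and with `T_α / ε²` for the deviations. -/
theorem measureReal_norm_discountedValue_sub_gt_lt {hX : Adapted ℱ X} {ha : Adapted ℱ a}
    (hZ : IsMarkovChain μ (pairProcess X a) (jointMatrix M P))
    (hM : ∀ l, M l ∈ Matrix.rowStochastic ℝ χ) (hP : ∀ s, P s ∈ stdSimplex ℝ I)
    (hret : ReturnTimeBound μ hX ha T) (hmix : StateMixing μ X a C) (hT : 0 < T)
    {α : ℝ} (hα : α ∈ Set.Ioo (0 : ℝ) 1) (g : χ → ℝ) {π : χ → I → ℝ}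
    (hπ : ∀ s, π s ∈ stdSimplex ℝ I) {ε δ : ℝ} (hε : 0 < ε) (hδ : δ ∈ Set.Ioo (0 : ℝ) 1)
    (hx : 0 < effectiveT α g T) {m : ℕ}
    (hcard : (1 : ℝ) ≤ (Fintype.card χ : ℝ) * (Fintype.card I : ℝ))
    (hm1 : 384 * (T * (1 + C)) * Real.log (2 * ((Fintype.card χ : ℝ) * (Fintype.card I : ℝ)) / δ)
      ≤ m)
    (hm2 : 768 * (effectiveT α g T / ε ^ 2)
      * Real.log (2 * ((Fintype.card χ : ℝ) * (Fintype.card I : ℝ)) / δ) ≤ m) :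
    μ.real {ω | ε < ‖WithLp.toLp 2
        (discountedValue α (policyMatrix π (empiricalMatrix X a m ω)) g
          - discountedValue α (policyMatrix π M) g)‖} < δ := by
  have hδ0 := hδ.1
  have hC := hmix.1
  have hT' : (0 : ℝ) < T := by exact_mod_cast hT
  set y := (Fintype.card χ : ℝ) * (Fintype.card I : ℝ) with hy
  set x := effectiveT α g T / ε ^ 2 with hxdef
  have hx0 : 0 < x := div_pos hx (by positivity)
  have hlog : 1 / 2 ≤ Real.log (2 * y / δ) := by
    have h1 : Real.log 2 ≤ Real.log (2 * y / δ) := by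
      refine Real.log_le_log (by norm_num) ?_
      rw [le_div_iff₀ hδ0]
      nlinarith [hδ.2]
    linarith [Real.log_two_gt_d9]
  set ℓ := Real.log (2 * y / δ) with hℓ
  have hpos : 0 < T * (1 + C) := by positivity
  have h4 : T * (4 + 2 * C) ≤ 4 * (T * (1 + C)) := by nlinarith
  have h4' : 0 < T * (4 + 2 * C) := by positivity
  have hm3 : 96 * (T * (4 + 2 * C)) * ℓ ≤ m := by nlinarith
  have hm4 : 2 * (T * (4 + 2 * C)) ≤ m := by nlinarith
  have hm0 : 0 < m := by
    have : (0 : ℝ) < m := by linarith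
    exact_mod_cast this
  have h1 := measureReal_norm_discountedValue_sub_gt_le hZ hP hM
    (frequentVisits_jointMatrix hZ hM hP hret hmix) hT hπ hα g hε hx hm0 hm4
  have h2 : y * Real.exp (-(m / (32 * (T * (4 + 2 * C))))) ≤ δ / 8 := by
    refine mul_exp_neg_le hcard hδ ?_
    rw [le_div_iff₀ (by positivity)]
    linarith
  have h3 : y * Real.exp (-(m / (256 * x))) ≤ δ / 8 := by
    refine mul_exp_neg_le hcard hδ ?_
    rw [le_div_iff₀ (by positivity)]
    linarith
  refine h1.trans_lt ?_
  rw [mul_add]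
  linarith

/-- The stated sample size dominates the one needed for the visit counts. If `C > 1`, the factor `2`
in the logarithm is absorbed because there are at least two state-control pairs. -/
theorem visit_sampleSize_le {T C y δ x ξ : ℝ} {m : ℕ} (hT : 2 ≤ T) (hC : 0 ≤ C) (hx : T ≤ x)
    (hδ : δ ∈ Set.Ioo (0 : ℝ) 1) (hy : 1 ≤ y) (hyC : C ≤ 1 ∨ 2 ≤ y)
    (hm1 : 1536 * (x * Real.log (2 * y / δ)) ≤ m)
    (hm2 : 1536 * (C ^ 2 * max (T ^ 2) ξ * Real.log (y / δ)) ≤ m) :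
    384 * (T * (1 + C)) * Real.log (2 * y / δ) ≤ m := by
  have hδ0 := hδ.1
  have hℓ : 0 ≤ Real.log (2 * y / δ) := by
    refine Real.log_nonneg ?_
    rw [le_div_iff₀ hδ0]
    linarith [hδ.2]
  rcases le_or_gt C 1 with hC1 | hC1
  · have h1 : T * (1 + C) * Real.log (2 * y / δ) ≤ x * 2 * Real.log (2 * y / δ) :=
      mul_le_mul_of_nonneg_right (mul_le_mul hx (by linarith) (by linarith) (by linarith)) hℓ
    have h2 : 0 ≤ x * Real.log (2 * y / δ) := mul_nonneg (by linarith) hℓ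
    linarith
  · have hy2 : 2 ≤ y := hyC.resolve_left (not_le.2 hC1)
    have hyδ : 2 ≤ y / δ := by
      rw [le_div_iff₀ hδ0]
      nlinarith [hδ.2]
    have h1 : Real.log (2 * y / δ) ≤ 2 * Real.log (y / δ) := by
      have h2 : Real.log ((y / δ) ^ 2) = 2 * Real.log (y / δ) := by
        rw [Real.log_pow]
        norm_num
      rw [← h2]
      refine Real.log_le_log (by positivity) ?_
      rw [mul_div_assoc, sq]
      exact mul_le_mul_of_nonneg_right hyδ (by linarith)
    have h3 : 0 ≤ Real.log (y / δ) := Real.log_nonneg (by linarith)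
    have h4 : T * (1 + C) ≤ 2 * (C ^ 2 * max (T ^ 2) ξ) := by
      have h5 : C ^ 2 * T ^ 2 ≤ C ^ 2 * max (T ^ 2) ξ :=
        mul_le_mul_of_nonneg_left (le_max_left _ _) (sq_nonneg C)
      have h6 : 1 ≤ C * T := by nlinarith
      nlinarith
    have h7 : T * (1 + C) * Real.log (2 * y / δ)
        ≤ 2 * (C ^ 2 * max (T ^ 2) ξ) * (2 * Real.log (y / δ)) :=
      mul_le_mul h4 h1 hℓ (by positivity)
    linarith

end SampleSize

end CMC

theorem mainTheorem3 :
    ∃ c : ℝ, 1 < c ∧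
      ∀ (Ω : Type*) (mΩ : MeasurableSpace Ω) (μ : Measure Ω) [IsProbabilityMeasure μ]
        (ℱ : Filtration ℕ mΩ)
        (χ : Type*) [Fintype χ] [DecidableEq χ] [MeasurableSpace χ] [MeasurableSingletonClass χ]
        (I : Type*) [Fintype I] [DecidableEq I] [MeasurableSpace I] [MeasurableSingletonClass I]
        (X : ℕ → Ω → χ) (a : ℕ → Ω → I) (M : I → Matrix χ χ ℝ)
        (hchain : CMC.IsControlledMarkovChain μ ℱ X a M)
        (_hstat : CMC.HasStationaryControls μ X a)
        (ζ₁ ζ₂ : ℝ) (_hnondeg : CMC.Nondegenerate μ X a ζ₁ ζ₂)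
        (T : ℕ)
        (_hreturn : CMC.ReturnTimeBound μ hchain.adapted_state hchain.adapted_control T)
        (Cθ : ℝ) (_hmix : CMC.StateMixing μ X a Cθ)
        (α : ℝ) (_hα : α ∈ Set.Ioo (0 : ℝ) 1) (g : χ → ℝ)
        (π : χ → I → ℝ) (_hπ : ∀ s, π s ∈ stdSimplex ℝ I)
        (ε δ : ℝ) (_hε : 0 < ε) (_hδ : δ ∈ Set.Ioo (0 : ℝ) 1) (m : ℕ)
        (_hm : c * max
            (CMC.effectiveT α g T / ε ^ 2 *
              Real.log ((Fintype.card χ : ℝ) * (Fintype.card I : ℝ) * CMC.effectiveT α g T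
                / (ε ^ 2 * δ)))
            (Cθ ^ 2 * max ((T : ℝ) ^ 2) (1 / (1 - max ζ₁ (1 - ζ₂)) ^ 2) *
              Real.log ((Fintype.card χ : ℝ) * (Fintype.card I : ℝ) / δ))
          < (m : ℝ)),
        μ.real {ω | ε <
          ‖WithLp.toLp 2
            (CMC.discountedValue α (CMC.policyMatrix π (CMC.empiricalMatrix X a m ω)) g
              - CMC.discountedValue α (CMC.policyMatrix π M) g)‖} < δ := by
  refine ⟨1536, by norm_num, ?_⟩
  intro Ω mΩ μ _ ℱ χ _ _ _ _ I _ _ _ _ X a M hchain hstat ζ₁ ζ₂ _ T hreturn Cθ hmix α hα g π hπ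
    ε δ hε hδ m hm
  obtain ⟨P, hP, hP0⟩ := hstat
  have hZ := hchain.isMarkovChain hP0
  obtain ⟨ω₀⟩ : Nonempty Ω := nonempty_of_isProbabilityMeasure μ
  have hT2 : 2 ≤ T := hreturn.two_le (X 0 ω₀) (a 0 ω₀)
  have hT0 : 0 < T := by omega
  have hT' : (2 : ℝ) ≤ T := by exact_mod_cast hT2
  have hδ0 := hδ.1
  rcases le_or_gt (CMC.effectiveT α g T / ε ^ 2) T with hx | hx
  · -- if `T_α / ε² ≤ T`, then the error exceeds `ε` for no trajectory at all
    have hempty : {ω | ε < ‖WithLp.toLp 2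
        (CMC.discountedValue α (CMC.policyMatrix π (CMC.empiricalMatrix X a m ω)) g
          - CMC.discountedValue α (CMC.policyMatrix π M) g)‖} = ∅ := by
      refine Set.eq_empty_iff_forall_notMem.2 fun ω hω => (not_lt.2 ?_ : ¬ ε < _) hω
      have h1 := CMC.norm_discountedValue_empirical_sub_sq_le (X := X) (a := a) (m := m) (ω := ω)
        hchain.stochastic hπ hα g hT0
      have h2 : CMC.effectiveT α g T / T ≤ ε ^ 2 := by
        rw [div_le_iff₀ (by positivity)] at hx
        rw [div_le_iff₀ (by linarith)]
        linarith
      exact le_of_sq_le_sq (h1.trans h2) hε.le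
    rw [hempty, measureReal_empty]
    exact hδ0
  set y := (Fintype.card χ : ℝ) * (Fintype.card I : ℝ) with hy
  have hcard : 1 ≤ Fintype.card χ * Fintype.card I :=
    Nat.mul_pos (Fintype.card_pos_iff.2 ⟨X 0 ω₀⟩) (Fintype.card_pos_iff.2 ⟨a 0 ω₀⟩)
  have hy1 : (1 : ℝ) ≤ y := by
    rw [hy]
    exact_mod_cast hcard
  have hx0 : 0 < CMC.effectiveT α g T / ε ^ 2 := by linarith
  have hxT : 0 < CMC.effectiveT α g T := by
    by_contra hcon
    exact absurd hx0 (not_lt.2 (div_nonpos_of_nonpos_of_nonneg (not_lt.1 hcon) (sq_nonneg ε)))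
  have hm1 : 1536 * (CMC.effectiveT α g T / ε ^ 2 * Real.log (2 * y / δ)) ≤ m := by
    refine le_trans (mul_le_mul_of_nonneg_left ?_ (by norm_num)) hm.le
    refine le_trans (mul_le_mul_of_nonneg_left ?_ hx0.le) (le_max_left _ _)
    refine Real.log_le_log (by positivity) ?_
    rw [show y * CMC.effectiveT α g T / (ε ^ 2 * δ) = CMC.effectiveT α g T / ε ^ 2 * y / δ by
      field_simp]
    exact div_le_div_of_nonneg_right
      (mul_le_mul_of_nonneg_right (by linarith) (by linarith)) hδ0.le
  have hm2 : 768 * (CMC.effectiveT α g T / ε ^ 2) * Real.log (2 * y / δ) ≤ m := by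
    have h1 : 0 ≤ Real.log (2 * y / δ) := by
      refine Real.log_nonneg ?_
      rw [le_div_iff₀ hδ0]
      linarith [hδ.2]
    have h2 := mul_nonneg hx0.le h1
    linarith
  have hm3 := (mul_le_mul_of_nonneg_left (le_max_right (CMC.effectiveT α g T / ε ^ 2 *
    Real.log (y * CMC.effectiveT α g T / (ε ^ 2 * δ))) _) (by norm_num)).trans hm.le
  rcases Nat.lt_or_ge 1 (Fintype.card χ * Fintype.card I) with hcard2 | hcard1
  · have hy2 : (2 : ℝ) ≤ y := by
      rw [hy]
      exact_mod_cast hcard2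
    refine CMC.measureReal_norm_discountedValue_sub_gt_lt hZ hchain.stochastic hP hreturn hmix hT0
      hα g hπ hε hδ hxT hy1 ?_ hm2
    exact CMC.visit_sampleSize_le hT' hmix.1 hx.le hδ hy1 (Or.inr hy2) hm1 hm3
  · -- a single state-control pair: the mixing constant may be replaced by `0`
    have : Subsingleton (χ × I) := by
      rw [← Fintype.card_le_one_iff_subsingleton, Fintype.card_prod]
      exact hcard1
    have hmix0 : CMC.StateMixing μ X a 0 := by
      refine ⟨le_rfl, fun i _ => ?_⟩
      simp only [CMC.thetaBar_eq_zero]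
      exact ⟨summable_zero, by simp⟩
    refine CMC.measureReal_norm_discountedValue_sub_gt_lt hZ hchain.stochastic hP hreturn hmix0 hT0
      hα g hπ hε hδ hxT hy1 ?_ hm2
    refine CMC.visit_sampleSize_le hT' le_rfl hx.le hδ hy1 (Or.inl zero_le_one) hm1 (ξ := 0) ?_
    simp
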